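/- **Setting.** Let $\mathcal X=[-1,1]^D$, let $f:\mathbb R^D\to\mathbb R$ be continuous, $f^*=\min_{\mathcal X} f$, and $G_\epsilon=\{x\in\mathcal X: f(x)\le f^*+\epsilon\}$. The function $f$ has effective dimension $d_e$ if $d_e$ is the smallest dimension of a linear subspace $\mathcal T$ such that $f(u+v)=f(u)$ for all $u\in\mathcal T$, $v\in\mathcal T^\perp$; such a $\mathcal T$ of dimension $d_e$ is an effective subspace. It is coordinate-aligned if it is spanned by $d_e$ of the standard basis vectors. Let $d\ge d_e$. A run of X-REGO on a probability space consists of random points $p^0,p^1,\dots$ that lie in $\mathcal X$ almost surely (deterministic, random or adaptive), of $D\times d$ Gaussian matrices $A^1,A^2,\dots$ (independent $N(0,1)$ entries), where $A^k$ is independent of $\mathcal F^{k-1}=\sigma(A^1,\dots,A^{k-1},y^1,\dots,y^{k-1},p^0,\dots,p^{k-1})$, and of random vectors $y^1,y^2,\dots$ in $\mathbb R^d$ such that $x^k:=A^ky^k+p^{k-1}\in\mathcal X$ almost surely. Let $x^k_{opt}$ be a point with the smallest value of $f$ among $x^1,\dots,x^k$, and let $f^k_{min}=\min\{f(A^ky+p^{k-1}):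 y\in\mathbb R^d,\ A^ky+p^{k-1}\in\mathcal X\}$. For $0<\lambda<\epsilon$ and $\rho\in(0,1]$, the *accuracy assumption* is that, for all $k\ge1$, almost surely $$\mathbb P\big[f(x^k)\le f^k_{min}+\lambda \,\big|\, \mathcal F^{k-1/2}\big]\ge\rho,\qquad \mathcal F^{k-1/2}=\sigma(A^1,\dots,A^k,y^1,\dots,y^{k-1},p^0,\dots,p^{k-1}).$$ **Theorem.** Fix $d_e\le d$. There is a function $\tau$ of $D$ (depending only on $d_e$, $d$), with values $\tau(D)\in(0,1]$ for $D>d_e$, such that the following holds for all $D>d_e$, every continuous $f:\mathbb R^D\to\mathbb R$ of effective dimension $d_e$ with a coordinate-aligned effective subspace, all $0<\lambda<\epsilon$, $\rho\in(0,1]$, $\xi\in(0,1)$, and every run of X-REGO that satisfies the accuracy assumption: $$\mathbb P[x^k_{opt}\in G_\epsilon]=\mathbb P[f(x^k_{opt})\le f^*+\epsilon]\ge\xi\quad\text{for all }k\ge K_\xi:=\left\lceil\frac{|\log(1-\xi)|}{\tau(D)\,\rho}\right\rceil ,$$ and $$K_\xi=\frac{|\log(1-\xi)|}{\rho}\,O\!\left(\frac{2^{D-d_e}(D-d_e+1)^{d_e}}{\log(D-d_e+1)^{(d-1)/2}}\right)\quad\text{as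 }D\to\infty .$$ If moreover $d_e\ge1$, there is such a function $\tau_0$ of $D$ for which the same holds for all runs with $p^k=0$ almost surely for all $k\ge0$ (with $\tau_0$ in place of $\tau$ in $K_\xi$), and now $$K_\xi=\frac{|\log(1-\xi)|}{\rho}\,O\!\left(\frac{(D-d_e+1)^{d_e}}{\log(D-d_e+1)^{(d-1)/2}}\right)\quad\text{as }D\to\infty .$$ In both cases the constant in $O(\cdot)$ depends only on $d_e$ and $d$, and for each $\xi$ the bound holds, uniformly in $\rho\in(0,1]$, for all $D$ larger than some threshold depending only on $d_e$, $d$ and $\xi$. -/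

import Mathlib

open MeasureTheory ProbabilityTheory Filter

namespace XREGO

noncomputable section

/-! ### The optimization problem -/

/-- The feasible box `[-1, 1]^D`. -/
def box (D : ℕ) : Set (EuclideanSpace ℝ (Fin D)) :=
  {x | ∀ i, x i ∈ Set.Icc (-1 : ℝ) 1}

/-- The optimal value `f^*` of `f` over the box (a minimum when `f` is continuous). -/
def optValue {D : ℕ} (f : EuclideanSpace ℝ (Fin D) → ℝ) : ℝ :=
  sInf (f '' box D)

/-- The set of feasible `ε`-minimizers. -/
def approxMinimizers {D : ℕ} (f : EuclideanSpace ℝ (Fin D) → ℝ) (ε : ℝ) :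
    Set (EuclideanSpace ℝ (Fin D)) :=
  {x | x ∈ box D ∧ f x ≤ optValue f + ε}

/-! ### Low effective dimensionality -/

/-- `f` does not change when a vector orthogonal to `T` is added to a vector of `T`. -/
def VariesOnlyAlong {D : ℕ} (f : EuclideanSpace ℝ (Fin D) → ℝ)
    (T : Submodule ℝ (EuclideanSpace ℝ (Fin D))) : Prop :=
  ∀ u ∈ T, ∀ v ∈ Tᗮ, f (u + v) = f u

/-- `f` has effective dimension `n`: the smallest dimension of a subspace along which
alone `f` varies is `n`. -/
def HasEffectiveDim {D : ℕ} (f : EuclideanSpace ℝ (Fin D) → ℝ) (n : ℕ) : Prop :=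
  IsLeast {k | ∃ T : Submodule ℝ (EuclideanSpace ℝ (Fin D)),
    Module.finrank ℝ T = k ∧ VariesOnlyAlong f T} n

/-- The coordinate subspace spanned by the basis vectors `e_i`, `i ∈ S`. -/
def coordSubspace {D : ℕ} (S : Finset (Fin D)) :
    Submodule ℝ (EuclideanSpace ℝ (Fin D)) :=
  Submodule.span ℝ ((fun i => EuclideanSpace.single i (1 : ℝ)) '' (S : Set (Fin D)))

/-- `f` is continuous, has effective dimension `n`, and a coordinate subspace of
dimension `n` is an effective subspace of `f`. -/
structure CoordinateAligned {D : ℕ} (f : EuclideanSpace ℝ (Fin D) → ℝ) (n : ℕ) : Prop where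
  continuous : Continuous f
  effectiveDim : HasEffectiveDim f n
  aligned : ∃ S : Finset (Fin D), S.card = n ∧ VariesOnlyAlong f (coordSubspace S)

/-! ### The reduced problem -/

/-- The point `A y + p` of the `D`-dimensional space. -/
def embed {D d : ℕ} (A : Fin D → Fin d → ℝ) (p : EuclideanSpace ℝ (Fin D))
    (y : EuclideanSpace ℝ (Fin d)) : EuclideanSpace ℝ (Fin D) :=
  WithLp.toLp 2 ((Matrix.of A).mulVec y.ofLp) + p

/-- The optimal value of the reduced problem: minimize `f (A y + p)` over all `y` such that
`A y + p` lies in the box (a minimum when `f` is continuous and `p` lies in the box). -/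
def reducedValue {D d : ℕ} (f : EuclideanSpace ℝ (Fin D) → ℝ) (A : Fin D → Fin d → ℝ)
    (p : EuclideanSpace ℝ (Fin D)) : ℝ :=
  sInf ((fun y => f (embed A p y)) '' {y | embed A p y ∈ box D})

/-! ### The algorithm as a stochastic process -/

section Runs

variable {Ω : Type*} [MeasurableSpace Ω] {D d : ℕ}

/-- A Gaussian random matrix: independent standard normal entries. -/
structure IsGaussianMatrix (A : Ω → Fin D → Fin d → ℝ) (μ : Measure Ω) : Prop where
  measurable : Measurable A
  law : ∀ i j, μ.map (fun ω => A ω i j) = gaussianReal 0 1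
  indep : iIndepFun (fun (ij : Fin D × Fin d) (ω : Ω) => A ω ij.1 ij.2) μ

/-- The `σ`-algebra generated by `A^1, …, A^k`, `y^1, …, y^k` and `p^0, …, p^k`. -/
abbrev history (A : ℕ → Ω → Fin D → Fin d → ℝ) (y : ℕ → Ω → EuclideanSpace ℝ (Fin d))
    (p : ℕ → Ω → EuclideanSpace ℝ (Fin D)) (k : ℕ) : MeasurableSpace Ω :=
  (⨆ j ∈ Finset.Icc 1 k, MeasurableSpace.comap (A j) inferInstance) ⊔
  (⨆ j ∈ Finset.Icc 1 k, MeasurableSpace.comap (y j) inferInstance) ⊔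
  (⨆ j ∈ Finset.range (k + 1), MeasurableSpace.comap (p j) inferInstance)

/-- For `k ≥ 1`, the `σ`-algebra generated by `A^1, …, A^k`, `y^1, …, y^(k-1)` and
`p^0, …, p^(k-1)`: the history just before the `k`-th reduced problem is solved. -/
abbrev halfHistory (A : ℕ → Ω → Fin D → Fin d → ℝ) (y : ℕ → Ω → EuclideanSpace ℝ (Fin d))
    (p : ℕ → Ω → EuclideanSpace ℝ (Fin D)) (k : ℕ) : MeasurableSpace Ω :=
  (⨆ j ∈ Finset.Icc 1 k, MeasurableSpace.comap (A j) inferInstance) ⊔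
  (⨆ j ∈ Finset.Ico 1 k, MeasurableSpace.comap (y j) inferInstance) ⊔
  (⨆ j ∈ Finset.range k, MeasurableSpace.comap (p j) inferInstance)

/-- The iterate `x^k = A^k y^k + p^(k-1)`, for `k ≥ 1`. -/
def iterate (A : ℕ → Ω → Fin D → Fin d → ℝ) (y : ℕ → Ω → EuclideanSpace ℝ (Fin d))
    (p : ℕ → Ω → EuclideanSpace ℝ (Fin D)) (k : ℕ) (ω : Ω) : EuclideanSpace ℝ (Fin D) :=
  embed (A k ω) (p (k - 1) ω) (y k ω)

/-- `(A^k)_{k ≥ 1}`, `(y^k)_{k ≥ 1}`, `(p^k)_{k ≥ 0}` are the random variables of a run of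
X-REGO: each `A^k` is a Gaussian matrix drawn independently of the past, the points `p^k` are
arbitrary (possibly random and adaptive) points of the box, and `y^k` is a feasible point of the
`k`-th reduced problem. The values of `A` and `y` at index `0` play no role. -/
structure IsRun (A : ℕ → Ω → Fin D → Fin d → ℝ) (y : ℕ → Ω → EuclideanSpace ℝ (Fin d))
    (p : ℕ → Ω → EuclideanSpace ℝ (Fin D)) (μ : Measure Ω) : Prop where
  gaussian : ∀ k, 1 ≤ k → IsGaussianMatrix (A k) μ
  measurable_y : ∀ k, 1 ≤ k → Measurable (y k)
  measurable_p : ∀ k, Measurable (p k)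
  fresh : ∀ k, Indep (MeasurableSpace.comap (A (k + 1)) inferInstance) (history A y p k) μ
  p_mem : ∀ k, ∀ᵐ ω ∂μ, p k ω ∈ box D
  feasible : ∀ k, 1 ≤ k → ∀ᵐ ω ∂μ, iterate A y p k ω ∈ box D

/-- The event that the `k`-th reduced problem is solved to accuracy `lam`. -/
def solvedEvent (f : EuclideanSpace ℝ (Fin D) → ℝ) (lam : ℝ)
    (A : ℕ → Ω → Fin D → Fin d → ℝ) (y : ℕ → Ω → EuclideanSpace ℝ (Fin d))
    (p : ℕ → Ω → EuclideanSpace ℝ (Fin D)) (k : ℕ) : Set Ω :=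
  {ω | f (iterate A y p k ω) ≤ reducedValue f (A k ω) (p (k - 1) ω) + lam}

/-- Conditionally on the history just before it is solved, each reduced problem is solved
to accuracy `lam` with probability at least `ρ`. -/
def AccuracyAssumption (f : EuclideanSpace ℝ (Fin D) → ℝ) (lam ρ : ℝ)
    (A : ℕ → Ω → Fin D → Fin d → ℝ) (y : ℕ → Ω → EuclideanSpace ℝ (Fin d))
    (p : ℕ → Ω → EuclideanSpace ℝ (Fin D)) (μ : Measure Ω) : Prop :=
  ∀ k, 1 ≤ k → ∀ᵐ ω ∂μ,
    ρ ≤ (μ[(solvedEvent f lam A y p k).indicator (fun _ => (1 : ℝ)) | halfHistory A y p k]) ω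

/-- `xopt k` is, for each `k ≥ 1`, a point with the smallest value of `f` among the iterates
`x^1, …, x^k` (ties are broken arbitrarily). -/
def IsBestPoint (f : EuclideanSpace ℝ (Fin D) → ℝ)
    (A : ℕ → Ω → Fin D → Fin d → ℝ) (y : ℕ → Ω → EuclideanSpace ℝ (Fin d))
    (p : ℕ → Ω → EuclideanSpace ℝ (Fin D)) (xopt : ℕ → Ω → EuclideanSpace ℝ (Fin D)) : Prop :=
  ∀ k, 1 ≤ k → ∀ ω, ∃ j ∈ Finset.Icc 1 k, xopt k ω = iterate A y p j ω ∧
    ∀ i ∈ Finset.Icc 1 k, f (xopt k ω) ≤ f (iterate A y p i ω)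

end Runs

/-! ### The number of embeddings and its growth -/

/-- `K_ξ = ⌈|log (1 - ξ)| / (τ ρ)⌉`. -/
def numEmbeddings (τ ρ ξ : ℝ) : ℕ :=
  ⌈|Real.log (1 - ξ)| / (τ * ρ)⌉₊

/-- `(D - n + 1)^n / log (D - n + 1)^((d - 1) / 2)`. -/
def algRate (n d D : ℕ) : ℝ :=
  ((D : ℝ) - n + 1) ^ n / Real.log ((D : ℝ) - n + 1) ^ (((d : ℝ) - 1) / 2)

/-- `2^(D - n) (D - n + 1)^n / log (D - n + 1)^((d - 1) / 2)`. -/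
def expRate (n d D : ℕ) : ℝ :=
  2 ^ (D - n) * ((D : ℝ) - n + 1) ^ n / Real.log ((D : ℝ) - n + 1) ^ (((d : ℝ) - 1) / 2)

/-- With `K_ξ` computed from the success probability `τ D` in dimension `D`:
`K_ξ = (|log (1 - ξ)| / ρ) O(r D)` as `D → ∞`. The constant `C` in `O` does not depend on `ξ`,
and the bound holds from some dimension on that does not depend on `ρ`. -/
def HasRate (τ r : ℕ → ℝ) : Prop :=
  ∃ C : ℝ, 0 < C ∧ ∀ ξ ∈ Set.Ioo (0 : ℝ) 1, ∀ᶠ D in atTop, ∀ ρ ∈ Set.Ioc (0 : ℝ) 1,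
    (numEmbeddings (τ D) ρ ξ : ℝ) ≤ |Real.log (1 - ξ)| / ρ * (C * r D)

end

end XREGO

/-! Fix a minimizer x over the box and the set S of the n effective coordinates. An embedding is
successful if some feasible `A y + p` agrees with x on S; its reduced value is then at most f^*. It
suffices to bound the probability of success below by some τ, uniformly over the admissible p: as
each new matrix is independent of the past, every round multiplies the probability of having missed
so far by at most 1 - τρ (`measureReal_missEvent_le`), and (1 - τρ)^k ≤ e^(-kτρ).

To bound τ, look for y in a small ball ‖y‖ ≤ s. The rows in S impose n Gaussian linear equations on
y. After a rotation only one of them has a nonzero right-hand side, and the size of a solution is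
governed by the norm of a Gaussian vector of dimension d + 1 - n; hence the factor `tailBound (d + 1
- n) u`, where u s bounds the right-hand side (`tailBound_le_solvable`). Once these rows have fixed
y, the other N = D - n constraints are independent, and each asks that ‖y‖ times a standard normal
variable lie in an interval (`le_gaussianMatrixLaw_successSet`). If p = 0 and s = 1/t, each holds
with probability at least P(|N(0,1)| ≤ t). For general p and s = 2/t a factor 1/2 may be lost,
because p_i can lie at an end of [-1, 1]; this is the source of 2^(D - n).

The radius balances the two effects: a small s helps the N constraints and hurts the equations.
`threshold` sets e^(-t²/2) = √(log (N + 1)) / (N + 1). The N constraints then keep a constant factor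
e^(-1) (besides the powers of 1/2), and the tail at u = √n t is at least a constant times log (N +
1)^((d - 1)/2) / (N + 1)^n. -/

namespace XREGO

/-! ### Gaussian measure of intervals -/

lemma gaussianPDFReal_std (x : ℝ) :
    gaussianPDFReal 0 1 x = (√(2 * Real.pi))⁻¹ * Real.exp (-x ^ 2 / 2) := by
  simp [gaussianPDFReal]

lemma gaussianReal_real_eq_integral (s : Set ℝ) :
    (gaussianReal 0 1).real s = ∫ x in s, gaussianPDFReal 0 1 x := by
  rw [Measure.real, gaussianReal_apply_eq_integral 0 one_ne_zero, ENNReal.toReal_ofReal]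
  exact integral_nonneg fun x => gaussianPDFReal_nonneg _ _ _

lemma gaussianReal_real_neg (s : Set ℝ) (hs : MeasurableSet s) :
    (gaussianReal 0 1).real (Neg.neg ⁻¹' s) = (gaussianReal 0 1).real s := by
  have h : (gaussianReal 0 1).map (fun x => -x) = gaussianReal 0 1 := by
    rw [gaussianReal_map_neg, neg_zero]
  conv_rhs => rw [← h]
  rw [map_measureReal_apply measurable_neg hs]

/-- The Gaussian tail bound `P(N > t) ≤ e^{-t²/2} / (2t)`. -/
lemma gaussianReal_real_Ioi_le {t : ℝ} (ht : 0 < t) :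
    (gaussianReal 0 1).real (Set.Ioi t) ≤ Real.exp (-t ^ 2 / 2) / t / 2 := by
  set C : ℝ := (√(2 * Real.pi))⁻¹ with hC
  have hC0 : 0 ≤ C := by positivity
  have hC2 : C ≤ 1 / 2 := by
    have h2 : (2 : ℝ) ≤ √(2 * Real.pi) := by
      apply Real.le_sqrt_of_sq_le
      nlinarith [Real.pi_gt_three]
    rw [hC, one_div]
    exact inv_anti₀ two_pos h2
  -- Multiplying the density by x / t, which is at least 1 beyond t, makes it an exact derivative.
  have hderiv : ∀ x : ℝ, HasDerivAt (fun x : ℝ => -(C / t) * Real.exp (-x ^ 2 / 2))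
      ((x / t) * gaussianPDFReal 0 1 x) x := by
    intro x
    have h1 : HasDerivAt (fun x : ℝ => -x ^ 2 / 2) (-x) x := by
      have := ((hasDerivAt_pow 2 x).neg.div_const 2)
      convert! this using 1
      norm_num
      ring
    have h2 := (h1.exp).const_mul (-(C / t))
    convert! h2 using 1
    rw [gaussianPDFReal_std]
    ring
  have htend : Tendsto (fun x : ℝ => -(C / t) * Real.exp (-x ^ 2 / 2)) atTop (nhds 0) := by
    have h1 : Tendsto (fun x : ℝ => -x ^ 2 / 2) atTop atBot := by
      have : Tendsto (fun x : ℝ => x ^ 2 / 2) atTop atTop :=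
        (tendsto_pow_atTop two_ne_zero).atTop_div_const two_pos
      exact (tendsto_neg_atTop_atBot.comp this).congr fun x => by simp [neg_div]
    simpa using (Real.tendsto_exp_atBot.comp h1).const_mul (-(C / t))
  have hint : IntegrableOn (fun x : ℝ => (x / t) * gaussianPDFReal 0 1 x) (Set.Ioi t) := by
    refine integrableOn_Ioi_deriv_of_nonneg (hderiv t).continuousAt.continuousWithinAt
      (fun x _ => hderiv x) (fun x hx => ?_) htend
    have : 0 < x := ht.trans hx
    have := gaussianPDFReal_nonneg 0 1 x
    positivity
  rw [gaussianReal_real_eq_integral]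
  calc ∫ x in Set.Ioi t, gaussianPDFReal 0 1 x
      ≤ ∫ x in Set.Ioi t, (x / t) * gaussianPDFReal 0 1 x := by
        refine setIntegral_mono_on (integrable_gaussianPDFReal 0 1).integrableOn hint
          measurableSet_Ioi fun x hx => ?_
        have h1 : 1 ≤ x / t := (one_le_div ht).2 (le_of_lt hx)
        exact le_mul_of_one_le_left (gaussianPDFReal_nonneg _ _ _) h1
    _ = 0 - -(C / t) * Real.exp (-t ^ 2 / 2) :=
        integral_Ioi_of_hasDerivAt_of_tendsto (hderiv t).continuousAt.continuousWithinAt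
          (fun x _ => hderiv x) hint htend
    _ = C * (Real.exp (-t ^ 2 / 2) / t) := by ring
    _ ≤ 1 / 2 * (Real.exp (-t ^ 2 / 2) / t) := by gcongr
    _ = _ := by ring

/-- A lower bound for the probability that a standard normal variable lies in `[-t, t]`. -/
noncomputable def centralBound (t : ℝ) : ℝ := 1 - Real.exp (-t ^ 2 / 2) / t

lemma centralBound_le {t : ℝ} (ht : 0 < t) :
    centralBound t ≤ (gaussianReal 0 1).real (Set.Icc (-t) t) := by
  have h1 : (Set.Icc (-t) t)ᶜ ⊆ Set.Ioi t ∪ Neg.neg ⁻¹' (Set.Ioi t) := by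
    intro x hx
    by_cases h : x ≤ t
    · right
      simp only [Set.mem_preimage, Set.mem_Ioi]
      by_contra h'
      exact hx ⟨by linarith, h⟩
    · left
      simpa using h
  have h2 : (gaussianReal 0 1).real (Set.Icc (-t) t)ᶜ ≤ Real.exp (-t ^ 2 / 2) / t :=
    calc _ ≤ (gaussianReal 0 1).real (Set.Ioi t ∪ Neg.neg ⁻¹' (Set.Ioi t)) :=
          measureReal_mono h1
      _ ≤ _ := measureReal_union_le _ _
      _ = (gaussianReal 0 1).real (Set.Ioi t) + (gaussianReal 0 1).real (Set.Ioi t) := by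
          rw [gaussianReal_real_neg _ measurableSet_Ioi]
      _ ≤ _ := by linarith [gaussianReal_real_Ioi_le ht]
  rw [probReal_compl_eq_one_sub measurableSet_Icc] at h2
  unfold centralBound
  linarith

lemma gaussianReal_real_Icc_neg_self_le (t : ℝ) :
    (gaussianReal 0 1).real (Set.Icc (-t) t) ≤ 2 * (gaussianReal 0 1).real (Set.Icc 0 t) := by
  have h1 : Set.Icc (-t) t ⊆ Set.Icc 0 t ∪ Neg.neg ⁻¹' (Set.Icc 0 t) := by
    intro x hx
    rcases le_total 0 x with h | h
    · exact Or.inl ⟨h, hx.2⟩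
    · exact Or.inr ⟨by linarith, by linarith [hx.1]⟩
  calc _ ≤ (gaussianReal 0 1).real (Set.Icc 0 t ∪ Neg.neg ⁻¹' (Set.Icc 0 t)) :=
        measureReal_mono h1
    _ ≤ _ := measureReal_union_le _ _
    _ = _ := by rw [gaussianReal_real_neg _ measurableSet_Icc]; ring

/-- Of all intervals of a given length that contain `0`, those with an end at `0` have the
smallest Gaussian measure. -/
lemma gaussianReal_real_Icc_zero_add_le {a b : ℝ} (ha : 0 ≤ a) (hb : 0 ≤ b) :
    (gaussianReal 0 1).real (Set.Icc 0 (a + b)) ≤ (gaussianReal 0 1).real (Set.Icc (-a) b) := by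
  have key : ∀ u v : ℝ, u ≤ v → (gaussianReal 0 1).real (Set.Icc u v) =
      ∫ x in u..v, gaussianPDFReal 0 1 x := by
    intro u v huv
    rw [gaussianReal_real_eq_integral, integral_Icc_eq_integral_Ioc,
      intervalIntegral.integral_of_le huv]
  have hi : ∀ u v : ℝ, IntervalIntegrable (gaussianPDFReal 0 1) volume u v :=
    fun u v => (integrable_gaussianPDFReal 0 1).intervalIntegrable
  have hsymm : ∫ x in (-a)..0, gaussianPDFReal 0 1 x =
      ∫ x in (0 : ℝ)..a, gaussianPDFReal 0 1 x := by
    have := intervalIntegral.integral_comp_neg (a := 0) (b := a) (gaussianPDFReal 0 1)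
    rw [neg_zero] at this
    rw [← this]
    refine intervalIntegral.integral_congr fun x _ => ?_
    simp [gaussianPDFReal_std]
  -- The part [-a, 0] is reflected to [0, a]; what remains of [0, a + b] is shifted left to [0, b],
  -- where the density is larger.
  have hshift : ∫ x in a..(a + b), gaussianPDFReal 0 1 x ≤
      ∫ x in (0 : ℝ)..b, gaussianPDFReal 0 1 x := by
    have := intervalIntegral.integral_comp_add_right (a := 0) (b := b) (gaussianPDFReal 0 1) a
    rw [zero_add, add_comm b a] at this
    rw [← this]
    refine intervalIntegral.integral_mono_on hb ?_ (hi _ _) fun x hx => ?_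
    · exact ((integrable_gaussianPDFReal 0 1).comp_add_right a).intervalIntegrable
    · rw [gaussianPDFReal_std, gaussianPDFReal_std]
      gcongr
      · exact hx.1
      · linarith
  rw [key _ _ (by linarith), key _ _ (by linarith),
    ← intervalIntegral.integral_add_adjacent_intervals (hi 0 a) (hi a (a + b)),
    ← intervalIntegral.integral_add_adjacent_intervals (hi (-a) 0) (hi 0 b), hsymm]
  linarith

/-- If `|p| ≤ 1` and `0 ≤ r ≤ 2 / t`, then `N r + p ∈ [-1, 1]` with probability about `1 / 2`
at least. -/
lemma half_centralBound_le {p r t : ℝ} (hp : p ∈ Set.Icc (-1 : ℝ) 1) (ht : 0 < t) (hr : 0 ≤ r)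
    (hrt : r ≤ 2 / t) :
    1 / 2 * centralBound t ≤
      (gaussianReal 0 1).real {x | r * x + p ∈ Set.Icc (-1 : ℝ) 1} := by
  have hsub : ∀ s : Set ℝ, (1 / 2 * centralBound t ≤ (gaussianReal 0 1).real s) →
      s ⊆ {x | r * x + p ∈ Set.Icc (-1 : ℝ) 1} → 1 / 2 * centralBound t ≤
      (gaussianReal 0 1).real {x | r * x + p ∈ Set.Icc (-1 : ℝ) 1} :=
    fun s h1 h2 => h1.trans (measureReal_mono h2)
  have h0 := centralBound_le ht
  have h1 := gaussianReal_real_Icc_neg_self_le t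
  rcases hr.eq_or_lt with rfl | hr
  · refine hsub (Set.Icc 0 t) (by linarith) fun x _ => ?_
    simpa using hp
  · refine hsub (Set.Icc (-((1 + p) / r)) ((1 - p) / r)) ?_ fun x hx => ?_
    · have ha : 0 ≤ (1 + p) / r := div_nonneg (by linarith [hp.1]) hr.le
      have hb : 0 ≤ (1 - p) / r := div_nonneg (by linarith [hp.2]) hr.le
      have h2 := gaussianReal_real_Icc_zero_add_le ha hb
      -- The admissible interval contains 0 and has length 2 / r ≥ t, wherever p lies.
      have h3 : t ≤ (1 + p) / r + (1 - p) / r := by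
        rw [← add_div, le_div_iff₀ hr]
        rw [le_div_iff₀ ht] at hrt
        linarith
      have h4 : (gaussianReal 0 1).real (Set.Icc 0 t) ≤
          (gaussianReal 0 1).real (Set.Icc 0 ((1 + p) / r + (1 - p) / r)) :=
        measureReal_mono (Set.Icc_subset_Icc_right h3)
      linarith
    · have h5 := hx.1
      have h6 := hx.2
      rw [neg_le, le_div_iff₀ hr] at h5
      rw [le_div_iff₀ hr] at h6
      constructor <;> linarith

/-- If `0 ≤ r ≤ 1 / t`, then `N r ∈ [-1, 1]` with probability close to `1`. -/
lemma centralBound_le_of_center {r t : ℝ} (ht : 0 < t) (hr : 0 ≤ r) (hrt : r ≤ 1 / t) :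
    centralBound t ≤ (gaussianReal 0 1).real {x | r * x + 0 ∈ Set.Icc (-1 : ℝ) 1} := by
  refine (centralBound_le ht).trans (measureReal_mono fun x hx => ?_)
  rw [le_div_iff₀ ht] at hrt
  have h1 : r * x ≤ r * t := mul_le_mul_of_nonneg_left hx.2 hr
  have h2 : r * -t ≤ r * x := mul_le_mul_of_nonneg_left hx.1 hr
  constructor <;> linarith

/-! ### The tail of the norm of a Gaussian vector -/

section Tail

variable {m : ℕ}

lemma pi_gaussianReal_eq_withDensity :
    Measure.pi (fun _ : Fin m => gaussianReal 0 1) =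
      (volume : Measure (Fin m → ℝ)).withDensity
        (fun x => ENNReal.ofReal (∏ i, gaussianPDFReal 0 1 (x i))) := by
  refine Measure.pi_eq fun s hs => ?_
  rw [withDensity_apply _ (MeasurableSet.univ_pi hs), volume_pi, Measure.restrict_pi_pi,
    ← ofReal_integral_eq_lintegral_ofReal, integral_fintype_prod_eq_prod,
    ENNReal.ofReal_prod_of_nonneg]
  · refine Finset.prod_congr rfl fun i _ => ?_
    rw [gaussianReal_apply_eq_integral _ one_ne_zero]
  · exact fun i _ => integral_nonneg fun x => gaussianPDFReal_nonneg _ _ _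
  · exact Integrable.fintype_prod fun i => (integrable_gaussianPDFReal 0 1).integrableOn
  · exact ae_of_all _ fun x => Finset.prod_nonneg fun i _ => gaussianPDFReal_nonneg _ _ _

lemma prod_gaussianPDFReal (x : EuclideanSpace ℝ (Fin m)) :
    ∏ i, gaussianPDFReal 0 1 (x i) =
      (√(2 * Real.pi))⁻¹ ^ m * Real.exp (-‖x‖ ^ 2 / 2) := by
  simp_rw [gaussianPDFReal_std, Finset.prod_mul_distrib, ← Real.exp_sum,
    EuclideanSpace.real_norm_sq_eq]
  simp [Finset.sum_div, neg_div]

lemma le_stdGaussian_of_norm_le {B : Set (EuclideanSpace ℝ (Fin m))} (hB : MeasurableSet B)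
    {R : ℝ} (hR : ∀ x ∈ B, ‖x‖ ≤ R) :
    ENNReal.ofReal ((√(2 * Real.pi))⁻¹ ^ m * Real.exp (-R ^ 2 / 2)) * volume B ≤
      stdGaussian (EuclideanSpace ℝ (Fin m)) B := by
  have hmeas : Measurable (WithLp.toLp 2 : (Fin m → ℝ) → EuclideanSpace ℝ (Fin m)) := by
    fun_prop
  rw [← map_pi_eq_stdGaussian, Measure.map_apply hmeas hB, pi_gaussianReal_eq_withDensity,
    withDensity_apply _ (hmeas hB), ← (PiLp.volume_preserving_toLp (Fin m)).measure_preimage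
      hB.nullMeasurableSet, ← setLIntegral_const]
  refine setLIntegral_mono_ae' (hmeas hB) (ae_of_all _ fun x hx => ?_)
  refine ENNReal.ofReal_le_ofReal ?_
  have h1 := hR _ hx
  have h2 := prod_gaussianPDFReal (WithLp.toLp 2 x)
  simp only at h2
  rw [h2]
  gcongr

/-- A lower bound for the probability that the norm of a standard Gaussian vector of dimension
`m` exceeds `u ≥ 1`. -/
noncomputable def tailBound (m : ℕ) (u : ℝ) : ℝ :=
  (√(2 * Real.pi))⁻¹ ^ m * Real.exp (-(3 / 2)) *
    (volume (Metric.ball (0 : EuclideanSpace ℝ (Fin m)) 1)).toReal *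
    (u ^ m / u ^ 2 * Real.exp (-u ^ 2 / 2))

lemma tailBound_pos {u : ℝ} (hu : 0 < u) : 0 < tailBound m u := by
  have h : 0 < (volume (Metric.ball (0 : EuclideanSpace ℝ (Fin m)) 1)).toReal :=
    ENNReal.toReal_pos (Metric.measure_ball_pos _ _ one_pos).ne' measure_ball_lt_top.ne
  unfold tailBound
  positivity

/-- Only the shell between the radii u and u + 1/u is counted. It is thin enough for the density to
drop by at most a constant factor, and thick enough to have at least u^(m-2) times the volume of the
unit ball. -/
lemma tailBound_le (hm : 1 ≤ m) {u : ℝ} (hu : 1 ≤ u) :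
    ENNReal.ofReal (tailBound m u) ≤
      stdGaussian (EuclideanSpace ℝ (Fin m)) {x | u ≤ ‖x‖} := by
  have hu0 : 0 < u := by linarith
  set E := EuclideanSpace ℝ (Fin m)
  set B : Set E := Metric.closedBall 0 (u + u⁻¹) \ Metric.ball 0 u with hB
  have hBm : MeasurableSet B := measurableSet_closedBall.diff measurableSet_ball
  have hsub : B ⊆ {x | u ≤ ‖x‖} := by
    intro x hx
    simpa [hB] using hx.2
  refine le_trans ?_ ((le_stdGaussian_of_norm_le hBm (R := u + u⁻¹) ?_).trans (measure_mono hsub))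
  · set V := volume (Metric.ball (0 : E) 1) with hV
    have hVtop : V ≠ ⊤ := measure_ball_lt_top.ne
    have hvol : ENNReal.ofReal (u ^ m / u ^ 2 * V.toReal) ≤ volume B := by
      have hball : volume (Metric.ball (0 : E) u) ≤ ENNReal.ofReal (u ^ m) * V := by
        refine (measure_mono Metric.ball_subset_closedBall).trans ?_
        rw [Measure.addHaar_closedBall _ _ hu0.le]
        simp [E, V]
      have hcl : volume (Metric.closedBall (0 : E) (u + u⁻¹)) =
          ENNReal.ofReal ((u + u⁻¹) ^ m) * V := by
        rw [Measure.addHaar_closedBall _ _ (by positivity)]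
        simp [E, V]
      refine le_trans ?_ (le_measure_sdiff (μ := volume) (s₁ := Metric.closedBall (0 : E) (u + u⁻¹))
        (s₂ := Metric.ball 0 u))
      rw [hcl]
      refine le_trans ?_ (tsub_le_tsub_left hball _)
      rw [← ENNReal.sub_mul (fun _ _ => hVtop), ← ENNReal.ofReal_sub _ (by positivity),
        ENNReal.ofReal_mul (by positivity), ENNReal.ofReal_toReal hVtop]
      gcongr
      have h1 : (u + u⁻¹) = u * (1 + (u ^ 2)⁻¹) := by field_simp
      -- Bernoulli's inequality; m ≥ 1 makes the linear term at least u⁻².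
      have h2 : 1 + (m : ℝ) * (u ^ 2)⁻¹ ≤ (1 + (u ^ 2)⁻¹) ^ m := by
        refine one_add_mul_le_pow ?_ m
        have : 0 ≤ (u ^ 2)⁻¹ := by positivity
        linarith
      rw [h1, mul_pow]
      have h3 : (1 : ℝ) ≤ m := by exact_mod_cast hm
      have h4 : 1 + (u ^ 2)⁻¹ ≤ (1 + (u ^ 2)⁻¹) ^ m := by
        refine le_trans ?_ h2
        have : 0 ≤ (u ^ 2)⁻¹ := by positivity
        nlinarith
      have h5 := mul_le_mul_of_nonneg_left h4 (show 0 ≤ u ^ m by positivity)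
      rw [div_eq_mul_inv]
      linarith
    refine le_trans ?_ (mul_le_mul_right hvol _)
    rw [← ENNReal.ofReal_mul (by positivity)]
    refine ENNReal.ofReal_le_ofReal ?_
    -- The constant 3/2 comes from (u + u⁻¹)² = u² + 2 + u⁻² ≤ u² + 3.
    have hexp : Real.exp (-(3 / 2)) * Real.exp (-u ^ 2 / 2) ≤
        Real.exp (-(u + u⁻¹) ^ 2 / 2) := by
      rw [← Real.exp_add]
      refine Real.exp_le_exp.2 ?_
      have h1 : u⁻¹ ≤ 1 := inv_le_one_of_one_le₀ hu
      have h2 : 0 < u⁻¹ := by positivity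
      have h3 : u * u⁻¹ = 1 := mul_inv_cancel₀ hu0.ne'
      nlinarith
    calc tailBound m u = (√(2 * Real.pi))⁻¹ ^ m *
          (Real.exp (-(3 / 2)) * Real.exp (-u ^ 2 / 2)) * (u ^ m / u ^ 2 * V.toReal) := by
          unfold tailBound; ring
      _ ≤ _ := by gcongr
  · intro x hx
    simpa [hB] using hx.1

end Tail

open scoped RealInnerProductSpace

/-! ### Underdetermined Gaussian linear systems -/

/-- Projection along a compact factor is a closed map. The norm bound on y thus makes the
solvability events below closed, hence measurable. -/
lemma isClosed_exists_mem_closedBall {X Y : Type*} [TopologicalSpace X] [SeminormedAddCommGroup Y]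
    [ProperSpace Y] {C : Set (X × Y)} (hC : IsClosed C) (s : ℝ) :
    IsClosed {x | ∃ y : Y, ‖y‖ ≤ s ∧ (x, y) ∈ C} := by
  have : CompactSpace (Metric.closedBall (0 : Y) s) :=
    isCompact_iff_compactSpace.1 (isCompact_closedBall 0 s)
  have h := (isClosedMap_fst_of_compactSpace (X := X) (Y := Metric.closedBall (0 : Y) s)) _
    (hC.preimage (f := fun q : X × Metric.closedBall (0 : Y) s => (q.1, (q.2 : Y))) (by fun_prop))
  convert! h using 1
  ext x
  simp

/-- If the fibres over `F` of a subset of a product have measure at least `q`, then the subset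
has measure at least `q` times that of `F`. -/
lemma pi_ge_of_fiber_ge {ι : Type*} [Fintype ι] {X : ι → Type*} [∀ i, MeasurableSpace (X i)]
    (μ : ∀ i, Measure (X i)) [∀ i, IsProbabilityMeasure (μ i)] (P : ι → Prop) [DecidablePred P]
    {E : Set (∀ i, X i)} (hE : MeasurableSet E) {F : Set (∀ i : {i // P i}, X i)}
    (hF : MeasurableSet F) (q : ENNReal)
    (h : ∀ a ∈ F, q ≤ Measure.pi (fun i : {i // ¬ P i} => μ i)
      {b | (Equiv.piEquivPiSubtypeProd P X).symm (a, b) ∈ E}) :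
    q * Measure.pi (fun i : {i // P i} => μ i) F ≤ Measure.pi μ E := by
  have hp := (measurePreserving_piEquivPiSubtypeProd μ P).symm
  rw [← hp.measure_preimage hE.nullMeasurableSet,
    Measure.prod_apply ((MeasurableEquiv.measurable _) hE), ← lintegral_indicator_const hF]
  refine lintegral_mono fun a => ?_
  by_cases ha : a ∈ F
  · rw [Set.indicator_of_mem ha]
    exact h a ha
  · simp [ha]

/-! ### Orthogonal invariance of Gaussian matrices -/

section Rotation

variable {ι : Type*} [Fintype ι] [DecidableEq ι]
  {E : Type*} [NormedAddCommGroup E] [InnerProductSpace ℝ E]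

lemma sum_mul_orthonormalBasis (b : OrthonormalBasis ι ℝ (EuclideanSpace ℝ ι)) (i j : ι) :
    ∑ k, b i k * b j k = if i = j then 1 else 0 := by
  have h := orthonormal_iff_ite.1 b.orthonormal i j
  rw [← h, PiLp.inner_apply]
  simp [mul_comm]

/-- The characteristic function of a product of standard Gaussians depends on t only through this
sum of squares. -/
lemma sum_norm_sq_rotate (b : OrthonormalBasis ι ℝ (EuclideanSpace ℝ ι)) (t : ι → E) :
    ∑ k, ‖∑ i, b i k • t i‖ ^ 2 = ∑ i, ‖t i‖ ^ 2 := by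
  calc ∑ k, ‖∑ i, b i k • t i‖ ^ 2
      = ∑ k, ∑ i, ∑ j, (b i k * b j k) * ⟪t i, t j⟫ := by
        refine Finset.sum_congr rfl fun k _ => ?_
        rw [← real_inner_self_eq_norm_sq, sum_inner]
        refine Finset.sum_congr rfl fun i _ => ?_
        rw [inner_sum]
        refine Finset.sum_congr rfl fun j _ => ?_
        rw [real_inner_smul_left, real_inner_smul_right]
        ring
    _ = ∑ i, ∑ j, (∑ k, b i k * b j k) * ⟪t i, t j⟫ := by
        rw [Finset.sum_comm]
        refine Finset.sum_congr rfl fun i _ => ?_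
        rw [Finset.sum_comm]
        simp_rw [Finset.sum_mul]
    _ = ∑ i, ‖t i‖ ^ 2 := by
        simp [sum_mul_orthonormalBasis]

variable [FiniteDimensional ℝ E] [MeasurableSpace E] [BorelSpace E]

/-- The law of a matrix with independent standard Gaussian rows is invariant under orthogonal
transformations of its columns. -/
lemma map_rotate_pi_stdGaussian (b : OrthonormalBasis ι ℝ (EuclideanSpace ℝ ι)) :
    (Measure.pi (fun _ : ι => stdGaussian E)).map (fun a i => ∑ k, b i k • a k) =
      Measure.pi (fun _ : ι => stdGaussian E) := by
  have hT : Measurable (fun (a : ι → E) i => ∑ k, b i k • a k) :=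
    measurable_pi_lambda _ fun i => Finset.measurable_sum _ fun k _ =>
      (measurable_pi_apply k).const_smul _
  have : IsProbabilityMeasure
      ((Measure.pi (fun _ : ι => stdGaussian E)).map (fun a i => ∑ k, b i k • a k)) :=
    Measure.isProbabilityMeasure_map hT.aemeasurable
  refine charFun_eq_pi_iff.1 fun t => ?_
  have hL : Measurable (WithLp.toLp 2 : (ι → E) → PiLp 2 fun _ : ι => E) := by fun_prop
  -- Pairing the rotated matrix with t is pairing the original matrix with the transposed rotation
  -- of t.
  have h1 : charFun (((Measure.pi (fun _ : ι => stdGaussian E)).map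
      (fun a i => ∑ k, b i k • a k)).map (WithLp.toLp 2)) t =
      charFun ((Measure.pi (fun _ : ι => stdGaussian E)).map (WithLp.toLp 2))
        (WithLp.toLp 2 fun k => ∑ i, b i k • t i) := by
    rw [charFun_apply, charFun_apply, Measure.map_map hL hT,
      integral_map (hL.comp hT).aemeasurable (by fun_prop),
      integral_map hL.aemeasurable (by fun_prop)]
    congr 1 with a
    congr 3
    simp only [PiLp.inner_apply, Function.comp_apply, sum_inner, inner_sum,
      real_inner_smul_left, real_inner_smul_right]
    exact Finset.sum_comm
  rw [h1, charFun_pi]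
  simp_rw [charFun_stdGaussian, ← Complex.exp_sum, ← Finset.sum_div, Finset.sum_neg_distrib]
  congr 3
  exact_mod_cast sum_norm_sq_rotate b t.ofLp

end Rotation

/-! ### Projections of Gaussian vectors and one inhomogeneous equation -/

section Projection

/-- If the `v j` in `tailBound_le_exists_orthogonal` are dependent, their orthogonal complement is
too large; cutting it down to dimension exactly m lets the single value `tailBound m u` serve. -/
lemma exists_submodule_le_finrank_eq {M : Type*} [AddCommGroup M] [Module ℝ M]
    (W : Submodule ℝ M) {m : ℕ} (hm : m ≤ Module.finrank ℝ W) :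
    ∃ V ≤ W, Module.finrank ℝ V = m := by
  obtain ⟨f, hf⟩ := exists_linearIndependent_of_le_finrank hm
  refine ⟨(Submodule.span ℝ (Set.range f)).map W.subtype, Submodule.map_subtype_le _ _, ?_⟩
  rw [Submodule.finrank_map_subtype_eq, finrank_span_eq_card hf, Fintype.card_fin]

variable {E : Type*} [NormedAddCommGroup E] [InnerProductSpace ℝ E] [FiniteDimensional ℝ E]
  [MeasurableSpace E] [BorelSpace E]

/-- Both characteristic functions at t ∈ V are exp(-‖t‖²/2), and the norm of t is the same in V and
in E. -/
lemma map_orthogonalProjection_stdGaussian (V : Submodule ℝ E) :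
    (stdGaussian E).map V.orthogonalProjectionOnto = stdGaussian V := by
  have hm : Measurable V.orthogonalProjectionOnto :=
    V.orthogonalProjectionOnto.continuous.measurable
  have : IsProbabilityMeasure ((stdGaussian E).map V.orthogonalProjectionOnto) :=
    Measure.isProbabilityMeasure_map hm.aemeasurable
  refine Measure.ext_of_charFun (funext fun t => ?_)
  have h1 : charFun ((stdGaussian E).map V.orthogonalProjectionOnto) t =
      charFun (stdGaussian E) (t : E) := by
    rw [charFun_apply, charFun_apply, integral_map hm.aemeasurable (by fun_prop)]
    simp
  rw [h1, charFun_stdGaussian, charFun_stdGaussian]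
  simp

lemma tailBound_le_orthogonalProjection {m : ℕ} (hm : 1 ≤ m) (V : Submodule ℝ E)
    (hV : Module.finrank ℝ V = m) {u : ℝ} (hu : 1 ≤ u) :
    ENNReal.ofReal (tailBound m u) ≤
      stdGaussian E {a | u ≤ ‖V.orthogonalProjectionOnto a‖} := by
  refine (tailBound_le hm hu).trans (le_of_eq ?_)
  subst hV
  let e := (stdOrthonormalBasis ℝ V).repr
  rw [← stdGaussian_map e, ← map_orthogonalProjection_stdGaussian,
    Measure.map_map e.continuous.measurable V.orthogonalProjectionOnto.continuous.measurable,
    Measure.map_apply (e.continuous.comp V.orthogonalProjectionOnto.continuous).measurable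
      (measurableSet_le measurable_const measurable_norm)]
  simp

/-- For a Gaussian vector `a`, the system `⟪a, y⟫ = c`, `y ⊥ v_j` for all `j`, has a solution of
norm at most `s` with probability at least `tailBound m u`, where `c ≤ u s` and
`m` is the dimension left over by the `v_j`. -/
lemma tailBound_le_exists_orthogonal {κ : Type*} [Fintype κ] (v : κ → E) {m : ℕ} (hm : 1 ≤ m)
    (hdim : m + Fintype.card κ ≤ Module.finrank ℝ E) {c u s : ℝ} (hc : 0 ≤ c) (hu : 1 ≤ u)
    (hcs : c ≤ u * s) :
    ENNReal.ofReal (tailBound m u) ≤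
      stdGaussian E {a | ∃ y : E, ‖y‖ ≤ s ∧ ⟪a, y⟫ = c ∧ ∀ j, ⟪v j, y⟫ = 0} := by
  have hfr : m ≤ Module.finrank ℝ (Submodule.span ℝ (Set.range v))ᗮ := by
    have h1 := Submodule.finrank_add_finrank_orthogonal (Submodule.span ℝ (Set.range v))
    have h2 : Module.finrank ℝ (Submodule.span ℝ (Set.range v)) ≤ Fintype.card κ :=
      finrank_range_le_card v
    omega
  obtain ⟨V, hVle, hV⟩ := exists_submodule_le_finrank_eq _ hfr
  refine (tailBound_le_orthogonalProjection hm V hV hu).trans (measure_mono fun a ha => ?_)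
  set P := V.orthogonalProjectionOnto a with hP
  have hu0 : 0 < u := by linarith
  have hP0 : 0 < ‖P‖ := hu0.trans_le ha
  -- The solution in V of least norm, namely c / ‖P‖.
  refine ⟨(c / ‖P‖ ^ 2) • (P : E), ?_, ?_, fun j => ?_⟩
  · rw [norm_smul, Real.norm_of_nonneg (by positivity), ← Submodule.coe_norm]
    have : c / ‖P‖ ^ 2 * ‖P‖ = c / ‖P‖ := by field_simp
    rw [this, div_le_iff₀ hP0]
    have hs : 0 ≤ s := nonneg_of_mul_nonneg_right (hc.trans hcs) hu0
    calc c ≤ u * s := hcs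
      _ ≤ ‖P‖ * s := by gcongr; exact ha
      _ = s * ‖P‖ := mul_comm _ _
  · have h1 : ⟪a, (P : E)⟫ = ‖P‖ ^ 2 := by
      rw [← Submodule.inner_orthogonalProjectionOnto_eq_of_mem_right, real_inner_self_eq_norm_sq,
        Submodule.coe_norm]
    rw [real_inner_smul_right, h1]
    field_simp
  · rw [real_inner_smul_right]
    have h1 : (P : E) ∈ (Submodule.span ℝ (Set.range v))ᗮ := hVle P.2
    rw [Submodule.inner_right_of_mem_orthogonal (Submodule.subset_span (Set.mem_range_self j)) h1, mul_zero]

end Projection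

/-! ### Solvability of the full system -/

section System

lemma isClosed_solvable {ι E : Type*} [NormedAddCommGroup E] [InnerProductSpace ℝ E]
    [FiniteDimensional ℝ E] (s : ℝ) (z : ι → ℝ) :
    IsClosed {a : ι → E | ∃ y : E, ‖y‖ ≤ s ∧ ∀ i, ⟪a i, y⟫ = z i} := by
  refine isClosed_exists_mem_closedBall
    (C := {q : (ι → E) × E | ∀ i, ⟪q.1 i, q.2⟫ = z i}) ?_ s
  simp only [Set.ofPred_forall]
  exact isClosed_iInter fun i => isClosed_eq (by fun_prop) continuous_const

variable {ι : Type*} [Fintype ι]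
  {E : Type*} [NormedAddCommGroup E] [InnerProductSpace ℝ E] [FiniteDimensional ℝ E]
  [MeasurableSpace E] [BorelSpace E]

/-- A system of Gaussian linear equations has a solution of norm at most `s` with probability at
least `tailBound m u`, where `u s` bounds the norm of the right-hand side and
`m - 1` is the number of unknowns minus the number of equations. -/
lemma tailBound_le_solvable [Nonempty ι] (z : EuclideanSpace ℝ ι) {m : ℕ} (hm : 1 ≤ m)
    (hdim : m + Fintype.card ι = Module.finrank ℝ E + 1) {u s : ℝ} (hu : 1 ≤ u)
    (hz : ‖z‖ ≤ u * s) :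
    ENNReal.ofReal (tailBound m u) ≤ Measure.pi (fun _ : ι => stdGaussian E)
      {a : ι → E | ∃ y : E, ‖y‖ ≤ s ∧ ∀ i, ⟪a i, y⟫ = z i} := by
  classical
  obtain ⟨i₀⟩ := ‹Nonempty ι›
  obtain ⟨e, he, hze⟩ : ∃ e : EuclideanSpace ℝ ι, ‖e‖ = 1 ∧ z = ‖z‖ • e := by
    by_cases h : z = 0
    · exact ⟨EuclideanSpace.single i₀ 1, by simp, by simp [h]⟩
    · have : ‖z‖ ≠ 0 := by simpa using h
      refine ⟨‖z‖⁻¹ • z, by rw [norm_smul, norm_inv, norm_norm, inv_mul_cancel₀ this], ?_⟩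
      rw [smul_smul, mul_inv_cancel₀ this, one_smul]
  -- In a basis whose `i₀`-th vector points along z, the right-hand side is ‖z‖ in equation `i₀` and
  -- zero in all others.
  obtain ⟨b, hb⟩ := Orthonormal.exists_orthonormalBasis_extension_of_card_eq
    (ι := ι) (E := EuclideanSpace ℝ ι) (𝕜 := ℝ) (by simp) (v := fun _ => e) (s := {i₀})
    (by
      constructor
      · intro i; simpa using he
      · intro i j hij; exact (hij (Subsingleton.elim _ _)).elim)
  have hb0 : b i₀ = e := hb i₀ rfl
  have hbz : ∀ i, ⟪b i, z⟫ = if i = i₀ then ‖z‖ else 0 := by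
    intro i
    rw [hze, ← hb0, real_inner_smul_right, orthonormal_iff_ite.1 b.orthonormal]
    split_ifs <;> simp [norm_smul]
  have hT : Measurable (fun (a : ι → E) i => ∑ k, b i k • a k) :=
    measurable_pi_lambda _ fun i => Finset.measurable_sum _ fun k _ =>
      (measurable_pi_apply k).const_smul _
  set G : Set (ι → E) := {a | ∃ y : E, ‖y‖ ≤ s ∧ ∀ i, ⟪a i, y⟫ = if i = i₀ then ‖z‖ else 0}
    with hG
  have hGm : MeasurableSet G := (isClosed_solvable s _).measurableSet
  have hsub : (fun (a : ι → E) i => ∑ k, b i k • a k) ⁻¹' G ⊆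
      {a : ι → E | ∃ y : E, ‖y‖ ≤ s ∧ ∀ i, ⟪a i, y⟫ = z i} := by
    rintro a ⟨y, hy, hya⟩
    refine ⟨y, hy, ?_⟩
    have h1 : (WithLp.toLp 2 fun k => ⟪a k, y⟫ : EuclideanSpace ℝ ι) = z := by
      refine b.repr.injective (PiLp.ext fun i => ?_)
      rw [b.repr_apply_apply, b.repr_apply_apply, hbz, ← hya i, sum_inner, PiLp.inner_apply]
      simp [real_inner_smul_left, mul_comm]
    intro i
    rw [← h1]
  refine le_trans ?_ (measure_mono hsub)
  rw [← Measure.map_apply hT hGm, map_rotate_pi_stdGaussian]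
  -- Condition on all rows except `i₀`: these are the vectors orthogonal to the sought y, and row
  -- `i₀` is still Gaussian.
  have h := pi_ge_of_fiber_ge (fun _ : ι => stdGaussian E) (fun i => i ≠ i₀) hGm
    (F := Set.univ) MeasurableSet.univ (ENNReal.ofReal (tailBound m u)) fun v _ => ?_
  · simpa using h
  have hcard : Fintype.card {i // i ≠ i₀} + 1 = Fintype.card ι := by
    rw [Fintype.card_subtype_compl, Fintype.card_subtype_eq]
    have := Fintype.card_pos_iff.2 ⟨i₀⟩
    omega
  refine (tailBound_le_exists_orthogonal v hm (by omega) (norm_nonneg z) hu hz).trans ?_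
  have hm0 := measurePreserving_eval
    (fun i : {i // ¬ i ≠ i₀} => stdGaussian E) ⟨i₀, by simp⟩
  have hU : IsClosed {a : E | ∃ y : E, ‖y‖ ≤ s ∧ ⟪a, y⟫ = ‖z‖ ∧ ∀ j, ⟪v j, y⟫ = 0} := by
    refine isClosed_exists_mem_closedBall
      (C := {q : E × E | ⟪q.1, q.2⟫ = ‖z‖ ∧ ∀ j, ⟪v j, q.2⟫ = 0}) ?_ s
    simp only [Set.ofPred_and, Set.ofPred_forall]
    exact (isClosed_eq (by fun_prop) continuous_const).inter
      (isClosed_iInter fun i => isClosed_eq (by fun_prop) continuous_const)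
  rw [← hm0.measure_preimage hU.measurableSet.nullMeasurableSet]
  refine measure_mono fun w => ?_
  rintro ⟨y, hy, hy0, hyv⟩
  refine ⟨y, hy, fun i => ?_⟩
  by_cases hi : i = i₀
  · subst hi
    simpa using hy0
  · simpa [hi] using hyv ⟨i, hi⟩

end System

/-! ### The success probability of one random embedding -/

/-- The law of a `D × d` matrix with independent standard normal entries. -/
noncomputable def gaussianMatrixLaw (D d : ℕ) : Measure (Fin D → Fin d → ℝ) :=
  Measure.pi fun _ => Measure.pi fun _ => gaussianReal 0 1

instance (D d : ℕ) : IsProbabilityMeasure (gaussianMatrixLaw D d) := by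
  unfold gaussianMatrixLaw; infer_instance

lemma IsGaussianMatrix.map_eq {Ω : Type*} [MeasurableSpace Ω] {D d : ℕ}
    {A : Ω → Fin D → Fin d → ℝ} {μ : Measure Ω} (h : IsGaussianMatrix A μ) :
    μ.map A = gaussianMatrixLaw D d := by
  have hij : ∀ ij : Fin D × Fin d, Measurable fun ω => A ω ij.1 ij.2 := fun ij =>
    (measurable_pi_apply ij.2).comp ((measurable_pi_apply ij.1).comp h.measurable)
  have h1 := h.indep.map_fun_eq_pi_map fun ij => (hij ij).aemeasurable
  simp_rw [h.law] at h1
  have h2 := Measure.infinitePi_map_curry (fun (_ : Fin D) (_ : Fin d) => gaussianReal 0 1)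
  simp_rw [Measure.infinitePi_eq_pi] at h2
  rw [← h1, Measure.map_map (MeasurableEquiv.measurable _) (measurable_pi_lambda _ hij)] at h2
  exact h2

lemma map_inner_stdGaussian {E : Type*} [NormedAddCommGroup E] [InnerProductSpace ℝ E]
    [FiniteDimensional ℝ E] [MeasurableSpace E] [BorelSpace E] (y : E) :
    (stdGaussian E).map (fun a => ⟪a, y⟫) = (gaussianReal 0 1).map (fun x => ‖y‖ * x) := by
  have h := IsGaussian.map_eq_gaussianReal (μ := stdGaussian E) (innerSL ℝ y)
  rw [variance_dual_stdGaussian, integral_strongDual_stdGaussian, innerSL_apply_norm] at h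
  rw [gaussianReal_map_const_mul]
  have h2 : (fun a => ⟪a, y⟫) = ⇑(innerSL ℝ y) := by
    ext a; simp [real_inner_comm]
  rw [h2, h]
  congr 1
  · simp
  · ext; simp

lemma embed_apply {D d : ℕ} (A : Fin D → Fin d → ℝ) (p : EuclideanSpace ℝ (Fin D))
    (y : EuclideanSpace ℝ (Fin d)) (i : Fin D) :
    embed A p y i = ⟪(WithLp.toLp 2 (A i) : EuclideanSpace ℝ (Fin d)), y⟫ + p i := by
  simp [embed, Matrix.mulVec, dotProduct, PiLp.inner_apply, mul_comm]

lemma continuous_embed {D d : ℕ} : Continuous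
    fun q : (EuclideanSpace ℝ (Fin D) × (Fin D → Fin d → ℝ)) × EuclideanSpace ℝ (Fin d) =>
      embed q.1.2 q.1.1 q.2 := by
  unfold embed
  refine Continuous.add ?_ (by fun_prop)
  refine (PiLp.continuous_toLp 2 _).comp ?_
  refine continuous_pi fun i => ?_
  simp only [Matrix.mulVec, dotProduct, Matrix.of_apply]
  fun_prop

lemma isCompact_box (D : ℕ) : IsCompact (box D) := by
  have h : box D =
      (EuclideanSpace.equiv (Fin D) ℝ) ⁻¹' (Set.univ.pi fun _ => Set.Icc (-1 : ℝ) 1) := by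
    ext x
    simp only [box, Set.mem_preimage, Set.mem_univ_pi]
    rfl
  rw [h]
  exact (EuclideanSpace.equiv (Fin D) ℝ).toHomeomorph.isCompact_preimage.2
    (isCompact_univ_pi fun _ => isCompact_Icc)

/-- The pairs `(p, A)` for which some feasible `A y + p` with `‖y‖ ≤ s` agrees with `x` on the
coordinates in `S`. -/
def successSet {D : ℕ} (d : ℕ) (S : Finset (Fin D)) (x : EuclideanSpace ℝ (Fin D)) (s : ℝ) :
    Set (EuclideanSpace ℝ (Fin D) × (Fin D → Fin d → ℝ)) :=
  {q | ∃ y, ‖y‖ ≤ s ∧ embed q.2 q.1 y ∈ box D ∧ ∀ i ∈ S, embed q.2 q.1 y i = x i}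

lemma isClosed_successSet {D d : ℕ} (S : Finset (Fin D)) (x : EuclideanSpace ℝ (Fin D)) (s : ℝ) :
    IsClosed (successSet d S x s) := by
  refine isClosed_exists_mem_closedBall
    (C := {q : (EuclideanSpace ℝ (Fin D) × (Fin D → Fin d → ℝ)) × EuclideanSpace ℝ (Fin d) |
      embed q.1.2 q.1.1 q.2 ∈ box D ∧ ∀ i ∈ S, embed q.1.2 q.1.1 q.2 i = x i}) ?_ s
  simp only [Set.ofPred_and, Set.ofPred_forall]
  refine ((isCompact_box D).isClosed.preimage continuous_embed).inter
    (isClosed_iInter fun i => isClosed_iInter fun _ => isClosed_eq ?_ continuous_const)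
  exact (EuclideanSpace.proj (𝕜 := ℝ) i).continuous.comp continuous_embed

lemma measurable_rows {D d : ℕ} : Measurable
    fun (A : Fin D → Fin d → ℝ) i => (WithLp.toLp 2 (A i) : EuclideanSpace ℝ (Fin d)) := by
  fun_prop

lemma map_rows_gaussianMatrixLaw (D d : ℕ) : (gaussianMatrixLaw D d).map
    (fun A i => (WithLp.toLp 2 (A i) : EuclideanSpace ℝ (Fin d))) =
      Measure.pi fun _ => stdGaussian (EuclideanSpace ℝ (Fin d)) := by
  unfold gaussianMatrixLaw
  have hm : Measurable (WithLp.toLp 2 : (Fin d → ℝ) → EuclideanSpace ℝ (Fin d)) := by fun_prop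
  have : SigmaFinite ((Measure.pi fun _ : Fin d => gaussianReal 0 1).map
      (WithLp.toLp 2 : (Fin d → ℝ) → EuclideanSpace ℝ (Fin d))) := by
    rw [map_pi_eq_stdGaussian]; infer_instance
  rw [Measure.pi_map_pi (fun _ => hm.aemeasurable)]
  simp_rw [map_pi_eq_stdGaussian]

/-- If the right-hand sides of the equations in the rows `S` have norm at most `u s`, and each
of the other constraints holds with probability at least `q` for every `y` with `‖y‖ ≤ s`, then an
embedding is successful with probability at least `tailBound (d + 1 - |S|) u * q ^ (D - |S|)`. -/
lemma le_gaussianMatrixLaw_successSet {D d : ℕ} (S : Finset (Fin D)) (hS : S.Nonempty)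
    (hSd : S.card ≤ d) {x p : EuclideanSpace ℝ (Fin D)} (hx : x ∈ box D)
    {u s q : ℝ} (hu : 1 ≤ u) (hs : 0 ≤ s) (hq : 0 ≤ q)
    (hz : ∑ i ∈ S, (x i - p i) ^ 2 ≤ (u * s) ^ 2)
    (hrow : ∀ i, i ∉ S → ∀ r, 0 ≤ r → r ≤ s →
      q ≤ (gaussianReal 0 1).real {t | r * t + p i ∈ Set.Icc (-1 : ℝ) 1}) :
    ENNReal.ofReal (tailBound (d + 1 - S.card) u * q ^ (D - S.card)) ≤
      gaussianMatrixLaw D d {A | (p, A) ∈ successSet d S x s} := by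
  set E := EuclideanSpace ℝ (Fin d)
  set G : Set (Fin D → E) := {a | ∃ y : E, ‖y‖ ≤ s ∧
    (∀ i ∈ S, ⟪a i, y⟫ + p i = x i) ∧ ∀ i, i ∉ S → ⟪a i, y⟫ + p i ∈ Set.Icc (-1 : ℝ) 1} with hG
  have hGm : MeasurableSet G := by
    refine (isClosed_exists_mem_closedBall (C := {w : (Fin D → E) × E |
      (∀ i ∈ S, ⟪w.1 i, w.2⟫ + p i = x i) ∧
        ∀ i, i ∉ S → ⟪w.1 i, w.2⟫ + p i ∈ Set.Icc (-1 : ℝ) 1}) ?_ s).measurableSet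
    simp only [Set.ofPred_and, Set.ofPred_forall]
    exact (isClosed_iInter fun i => isClosed_iInter fun _ => isClosed_eq
      (by fun_prop) continuous_const).inter (isClosed_iInter fun i => isClosed_iInter fun _ =>
        isClosed_Icc.preimage (by fun_prop))
  have hsub : (fun (A : Fin D → Fin d → ℝ) i => (WithLp.toLp 2 (A i) : E)) ⁻¹' G ⊆
      {A | (p, A) ∈ successSet d S x s} := by
    rintro A ⟨y, hy, h1, h2⟩
    refine ⟨y, hy, fun i => ?_, fun i hi => by rw [embed_apply]; exact h1 i hi⟩
    rw [embed_apply]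
    by_cases hi : i ∈ S
    · have := h1 i hi
      simp only at this ⊢
      rw [this]
      exact hx i
    · exact h2 i hi
  refine le_trans ?_ (measure_mono hsub)
  rw [← Measure.map_apply measurable_rows hGm, map_rows_gaussianMatrixLaw]
  have hne : Nonempty {i // i ∈ S} := hS.to_subtype
  set z : EuclideanSpace ℝ {i // i ∈ S} := WithLp.toLp 2 fun i => x i - p i with hzdef
  have hznorm : ‖z‖ ≤ u * s := by
    refine le_of_sq_le_sq ?_ (by positivity)
    rw [EuclideanSpace.real_norm_sq_eq]
    refine le_trans (le_of_eq ?_) hz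
    rw [← Finset.sum_coe_sort S]
  have hrows := tailBound_le_solvable (E := E) z (m := d + 1 - S.card) (by omega)
    (by simp [E]; omega) hu hznorm
  -- Condition on the rows in S, from which alone y is chosen, so that the other rows stay
  -- independent of it. No measurable choice of y is needed, since only the measure of each fibre
  -- enters.
  refine le_trans ?_ (pi_ge_of_fiber_ge (fun _ : Fin D => stdGaussian E) (fun i => i ∈ S) hGm
    (isClosed_solvable s z).measurableSet (ENNReal.ofReal (q ^ (D - S.card))) ?_)
  · rw [mul_comm, ENNReal.ofReal_mul (by positivity)]
    gcongr
    refine hrows.trans_eq ?_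
    congr!
  · rintro a ⟨y, hy, hya⟩
    have hsub2 : (Set.univ.pi fun i : {i // i ∉ S} =>
        (fun b : E => ⟪b, y⟫) ⁻¹' {t | t + p i ∈ Set.Icc (-1 : ℝ) 1}) ⊆
        {b | (Equiv.piEquivPiSubtypeProd (fun i => i ∈ S) fun _ => E).symm (a, b) ∈ G} := by
      intro b hb
      refine ⟨y, hy, fun i hi => ?_, fun i hi => ?_⟩
      · have := hya ⟨i, hi⟩
        simp only [hzdef] at this
        simp [hi, this]
      · have := hb ⟨i, hi⟩ (Set.mem_univ _)
        simpa [hi] using this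
    refine le_trans ?_ (measure_mono hsub2)
    rw [Measure.pi_pi]
    have hcard : Fintype.card {i // i ∉ S} = D - S.card := by
      rw [Fintype.card_subtype_compl, Fintype.card_fin, Fintype.card_coe]
    rw [← hcard, ENNReal.ofReal_pow hq, ← Finset.card_univ, ← Finset.prod_const]
    refine Finset.prod_le_prod' fun i _ => ?_
    have hI : MeasurableSet {t : ℝ | t + p i ∈ Set.Icc (-1 : ℝ) 1} :=
      (isClosed_Icc.preimage (by fun_prop : Continuous fun t : ℝ => t + p i)).measurableSet
    rw [← Measure.map_apply (by fun_prop) hI, map_inner_stdGaussian,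
      Measure.map_apply (by fun_prop) hI]
    have := hrow i i.2 ‖y‖ (norm_nonneg y) hy
    exact ENNReal.ofReal_le_of_le_toReal this

/-! ### The objective function -/

section Objective

variable {D : ℕ} {f : EuclideanSpace ℝ (Fin D) → ℝ}

/-- A function that varies only along a coordinate subspace depends only on these coordinates. -/
lemma VariesOnlyAlong.eq_of_agree {S : Finset (Fin D)} (h : VariesOnlyAlong f (coordSubspace S))
    {x x' : EuclideanSpace ℝ (Fin D)} (hxx : ∀ i ∈ S, x i = x' i) : f x = f x' := by
  -- z differs from its part in the coordinates S by a vector orthogonal to the coordinate subspace,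
  -- which f ignores.
  have key : ∀ z : EuclideanSpace ℝ (Fin D),
      f z = f (∑ i ∈ S, z i • EuclideanSpace.single i (1 : ℝ)) := by
    intro z
    set w := ∑ i ∈ S, z i • EuclideanSpace.single i (1 : ℝ) with hw
    have hwmem : w ∈ coordSubspace S := Submodule.sum_mem _ fun i hi =>
      Submodule.smul_mem _ _ (Submodule.subset_span ⟨i, hi, rfl⟩)
    have horth : z - w ∈ (coordSubspace S)ᗮ := by
      rw [Submodule.mem_orthogonal]
      intro u hu
      induction hu using Submodule.span_induction with
      | mem u hu =>
        obtain ⟨i, hi, rfl⟩ := hu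
        rw [EuclideanSpace.inner_single_left]
        have hi' : i ∈ S := hi
        simp [hw, Finset.sum_apply, Pi.single_apply, hi']
      | zero => simp
      | add u v _ _ hu hv => rw [inner_add_left, hu, hv, add_zero]
      | smul c u _ hu => rw [inner_smul_left, hu, mul_zero]
    rw [← h w hwmem _ horth, add_sub_cancel]
  rw [key x, key x', Finset.sum_congr rfl fun i hi => by rw [hxx i hi]]

lemma exists_optValue_eq (hf : Continuous f) : ∃ x ∈ box D, optValue f = f x := by
  obtain ⟨x, hx, h⟩ := (isCompact_box D).exists_sInf_image_eq ⟨0, fun i => by simp⟩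
    hf.continuousOn
  exact ⟨x, hx, h⟩

lemma optValue_le (hf : Continuous f) {x : EuclideanSpace ℝ (Fin D)} (hx : x ∈ box D) :
    optValue f ≤ f x :=
  csInf_le ((isCompact_box D).bddBelow_image hf.continuousOn) ⟨x, hx, rfl⟩

lemma reducedValue_le (hf : Continuous f) {d : ℕ} {A : Fin D → Fin d → ℝ}
    {p : EuclideanSpace ℝ (Fin D)} {y : EuclideanSpace ℝ (Fin d)} (hy : embed A p y ∈ box D) :
    reducedValue f A p ≤ f (embed A p y) := by
  refine csInf_le ⟨optValue f, ?_⟩ ⟨y, hy, rfl⟩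
  rintro _ ⟨y', hy', rfl⟩
  exact optValue_le hf hy'

/-- A feasible point that agrees with the minimizer x on S has the same value, as f sees only these
coordinates. -/
lemma reducedValue_le_optValue (hf : Continuous f) {S : Finset (Fin D)}
    (hS : VariesOnlyAlong f (coordSubspace S)) {x : EuclideanSpace ℝ (Fin D)}
    (hx : optValue f = f x) {d : ℕ} {A : Fin D → Fin d → ℝ} {p : EuclideanSpace ℝ (Fin D)} {s : ℝ}
    (h : (p, A) ∈ successSet d S x s) : reducedValue f A p ≤ optValue f := by
  obtain ⟨y, -, hy, hyx⟩ := h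
  rw [hx, ← hS.eq_of_agree hyx]
  exact reducedValue_le hf hy

end Objective

/-! ### The runs -/

section Run

variable {Ω : Type*} {D d : ℕ}
  {A : ℕ → Ω → Fin D → Fin d → ℝ} {y : ℕ → Ω → EuclideanSpace ℝ (Fin d)}
  {p : ℕ → Ω → EuclideanSpace ℝ (Fin D)} {f : EuclideanSpace ℝ (Fin D) → ℝ}

/-- The two filtrations interlace: `p k` is known before `A (k + 1)` is drawn, and `A (k + 1)`
before `y (k + 1)` is chosen. -/
lemma history_le_halfHistory (k : ℕ) : history A y p k ≤ halfHistory A y p (k + 1) := by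
  refine sup_le_sup (sup_le_sup ?_ ?_) le_rfl
  · exact biSup_mono fun j hj => by simp at hj ⊢; omega
  · exact biSup_mono fun j hj => by simp at hj ⊢; omega

lemma halfHistory_le_history (k : ℕ) : halfHistory A y p (k + 1) ≤ history A y p (k + 1) := by
  refine sup_le_sup (sup_le_sup le_rfl ?_) ?_
  · exact biSup_mono fun j hj => by simp at hj ⊢; omega
  · exact biSup_mono fun j hj => by simp at hj ⊢; omega

lemma measurable_history_p (k : ℕ) : Measurable[history A y p k] (p k) :=
  Measurable.of_comap_le <| le_sup_of_le_right <|
    le_iSup₂_of_le (f := fun j _ => MeasurableSpace.comap (p j) _) k (by simp) le_rfl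

lemma measurable_halfHistory_p (k : ℕ) : Measurable[halfHistory A y p (k + 1)] (p k) :=
  (measurable_history_p k).mono (history_le_halfHistory k) le_rfl

lemma measurable_halfHistory_A (k : ℕ) : Measurable[halfHistory A y p (k + 1)] (A (k + 1)) :=
  Measurable.of_comap_le <| le_sup_of_le_left <| le_sup_of_le_left <|
    le_iSup₂_of_le (f := fun j _ => MeasurableSpace.comap (A j) _) (k + 1) (by simp) le_rfl

lemma measurable_history_y (k : ℕ) : Measurable[history A y p (k + 1)] (y (k + 1)) :=
  Measurable.of_comap_le <| le_sup_of_le_left <| le_sup_of_le_right <|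
    le_iSup₂_of_le (f := fun j _ => MeasurableSpace.comap (y j) _) (k + 1) (by simp) le_rfl

lemma measurable_iterate (k : ℕ) :
    Measurable[history A y p (k + 1)] (iterate A y p (k + 1)) := by
  have h1 := (measurable_halfHistory_p (A := A) (y := y) (p := p) k).mono
    (halfHistory_le_history k) le_rfl
  have h2 := (measurable_halfHistory_A (A := A) (y := y) (p := p) k).mono
    (halfHistory_le_history k) le_rfl
  have h3 : Measurable[history A y p (k + 1)] fun ω => ((p k ω, A (k + 1) ω), y (k + 1) ω) :=
    (h1.prodMk h2).prodMk (measurable_history_y k)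
  have h4 := (continuous_embed (D := D) (d := d)).measurable.comp h3
  exact h4

lemma history_mono {j k : ℕ} (hjk : j ≤ k) : history A y p j ≤ history A y p k := by
  refine sup_le_sup (sup_le_sup ?_ ?_) ?_ <;>
    exact biSup_mono fun i hi => by simp at hi ⊢; omega

/-- The event that none of `x^1, …, x^k` is a `lam`-minimizer. -/
def missEvent (f : EuclideanSpace ℝ (Fin D) → ℝ) (lam : ℝ)
    (A : ℕ → Ω → Fin D → Fin d → ℝ) (y : ℕ → Ω → EuclideanSpace ℝ (Fin d))
    (p : ℕ → Ω → EuclideanSpace ℝ (Fin D)) (k : ℕ) : Set Ω :=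
  {ω | ∀ j ∈ Finset.Icc 1 k, optValue f + lam < f (iterate A y p j ω)}

lemma measurableSet_missEvent (hf : Continuous f) (lam : ℝ) (k : ℕ) :
    MeasurableSet[history A y p k] (missEvent f lam A y p k) := by
  have h1 : missEvent f lam A y p k = ⋂ j ∈ Finset.Icc 1 k,
      {ω | optValue f + lam < f (iterate A y p j ω)} := by
    ext ω; simp [missEvent]
  rw [h1]
  refine Finset.measurableSet_biInter _ fun j hj => ?_
  obtain ⟨i, rfl⟩ : ∃ i, j = i + 1 := ⟨j - 1, by have := (Finset.mem_Icc.1 hj).1; omega⟩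
  exact ((hf.measurable.comp (measurable_iterate i)).mono
    (history_mono (Finset.mem_Icc.1 hj).2) le_rfl) measurableSet_Ioi

variable [mΩ : MeasurableSpace Ω] {μ : Measure Ω}

lemma history_le (h : IsRun A y p μ) (k : ℕ) : history A y p k ≤ mΩ := by
  refine sup_le (sup_le ?_ ?_) ?_
  · exact iSup₂_le fun j hj => (h.gaussian j (Finset.mem_Icc.1 hj).1).measurable.comap_le
  · exact iSup₂_le fun j hj => (h.measurable_y j (Finset.mem_Icc.1 hj).1).comap_le
  · exact iSup₂_le fun j _ => (h.measurable_p j).comap_le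

lemma halfHistory_le (h : IsRun A y p μ) (k : ℕ) : halfHistory A y p k ≤ mΩ := by
  refine sup_le (sup_le ?_ ?_) ?_
  · exact iSup₂_le fun j hj => (h.gaussian j (Finset.mem_Icc.1 hj).1).measurable.comap_le
  · exact iSup₂_le fun j hj => (h.measurable_y j (Finset.mem_Ico.1 hj).1).comap_le
  · exact iSup₂_le fun j _ => (h.measurable_p j).comap_le

/-- A new embedding is successful with probability at least `τ`, given the history. -/
lemma le_measure_inter_success [IsProbabilityMeasure μ] (h : IsRun A y p μ) {k : ℕ} {C : Set Ω}
    (hC : MeasurableSet[history A y p k] C)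
    {G : Set (EuclideanSpace ℝ (Fin D) × (Fin D → Fin d → ℝ))} (hG : MeasurableSet G)
    {τ : ENNReal} (hτ : ∀ᵐ ω ∂μ, τ ≤ gaussianMatrixLaw D d {M | (p k ω, M) ∈ G}) :
    τ * μ C ≤ μ (C ∩ {ω | (p k ω, A (k + 1) ω) ∈ G}) := by
  have hA : Measurable (A (k + 1)) := (h.gaussian (k + 1) (by omega)).measurable
  have hp := h.measurable_p k
  have hpA : Measurable fun ω => (p k ω, A (k + 1) ω) := hp.prodMk hA
  have hCm : MeasurableSet C := history_le h k C hC
  -- Both C and `p k` belong to the history, so even on C the fresh matrix is independent of `p k`;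
  -- the bound then follows by Fubini.
  have hlaw : ((μ.restrict C).map (p k)).prod (gaussianMatrixLaw D d) =
      (μ.restrict C).map fun ω => (p k ω, A (k + 1) ω) := by
    refine Measure.prod_eq fun U V hU hV => ?_
    rw [Measure.map_apply hpA (hU.prod hV), Measure.map_apply hp hU,
      Measure.restrict_apply (hp hU), Measure.restrict_apply (hpA (hU.prod hV)),
      ← (h.gaussian (k + 1) (by omega)).map_eq, Measure.map_apply hA hV]
    have hind := (Indep_iff _ _ μ).1 (h.fresh k) (A (k + 1) ⁻¹' V) (p k ⁻¹' U ∩ C)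
      ⟨V, hV, rfl⟩ ((measurable_history_p k hU).inter hC)
    rw [mul_comm, ← hind]
    congr 1
    ext ω
    simp only [Set.mem_inter_iff, Set.mem_preimage, Set.mem_prod]
    tauto
  calc τ * μ C = ∫⁻ _, τ ∂((μ.restrict C).map (p k)) := by
        rw [lintegral_const, Measure.map_apply hp MeasurableSet.univ]
        simp
    _ ≤ ∫⁻ x, gaussianMatrixLaw D d (Prod.mk x ⁻¹' G) ∂((μ.restrict C).map (p k)) := by
        rw [lintegral_map measurable_const hp, lintegral_map (measurable_measure_prodMk_left hG) hp]
        exact lintegral_mono_ae (ae_restrict_of_ae hτ)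
    _ = ((μ.restrict C).map fun ω => (p k ω, A (k + 1) ω)) G := by
        rw [← hlaw, Measure.prod_apply hG]
    _ = μ (C ∩ {ω | (p k ω, A (k + 1) ω) ∈ G}) := by
        rw [Measure.map_apply hpA hG, Measure.restrict_apply (hpA hG), Set.inter_comm]
        rfl

/-- Each reduced problem is solved with probability at least `ρ`, given the history. -/
lemma le_measure_inter_solved [IsProbabilityMeasure μ] (h : IsRun A y p μ) {lam ρ : ℝ} (hρ : 0 < ρ)
    (hacc : AccuracyAssumption f lam ρ A y p μ) {k : ℕ} (hk : 1 ≤ k) {F : Set Ω}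
    (hF : MeasurableSet[halfHistory A y p k] F) :
    ρ * μ.real F ≤ μ.real (F ∩ solvedEvent f lam A y p k) := by
  set V := solvedEvent f lam A y p k
  have hm := halfHistory_le h k
  have hFm : MeasurableSet F := hm F hF
  -- The event is not assumed measurable. If its indicator were not integrable, the conditional
  -- expectation would be 0 by convention, contradicting ρ > 0; null measurability follows.
  have hint : Integrable (V.indicator fun _ => (1 : ℝ)) μ := by
    by_contra hn
    have h1 := hacc k hk
    rw [condExp_of_not_integrable hn] at h1
    obtain ⟨ω, hω⟩ := h1.exists
    simp only [Pi.zero_apply] at hω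
    linarith
  have hV : NullMeasurableSet V μ :=
    (aemeasurable_indicator_const_iff (1 : ℝ)).1 hint.aestronglyMeasurable.aemeasurable
  calc ρ * μ.real F = ∫ _ in F, ρ ∂μ := by simp [mul_comm]
    _ ≤ ∫ ω in F, (μ[V.indicator (fun _ => (1 : ℝ)) | halfHistory A y p k]) ω ∂μ :=
        integral_mono_ae (integrable_const _).integrableOn integrable_condExp.integrableOn
          (ae_restrict_of_ae (hacc k hk))
    _ = ∫ ω in F, V.indicator (fun _ => (1 : ℝ)) ω ∂μ := setIntegral_condExp hm hint hF
    _ = μ.real (F ∩ V) := by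
        rw [integral_indicator₀ (hV.mono_ac Measure.restrict_le_self.absolutelyContinuous)]
        simp [Measure.restrict_restrict₀ (hV.mono_ac Measure.restrict_le_self.absolutelyContinuous),
          Set.inter_comm]

/-- After a miss, the next embedding is successful with probability at least τ, and is then solved
with probability at least ρ. Both together yield a `lam`-minimizer, so a fraction of at most 1 - τρ
of the miss event survives. -/
lemma measureReal_missEvent_le [IsProbabilityMeasure μ] (h : IsRun A y p μ) (hf : Continuous f)
    {S : Finset (Fin D)} (hS : VariesOnlyAlong f (coordSubspace S)) {x : EuclideanSpace ℝ (Fin D)}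
    (hx : optValue f = f x) {s τ lam ρ : ℝ} (hτ : τ ∈ Set.Icc (0 : ℝ) 1) (hρ : ρ ∈ Set.Ioc (0 : ℝ) 1)
    (hsucc : ∀ k, ∀ᵐ ω ∂μ, ENNReal.ofReal τ ≤
      gaussianMatrixLaw D d {M | (p k ω, M) ∈ successSet d S x s})
    (hacc : AccuracyAssumption f lam ρ A y p μ) (k : ℕ) :
    μ.real (missEvent f lam A y p k) ≤ (1 - τ * ρ) ^ k := by
  induction k with
  | zero => simp
  | succ k ih =>
    set B := missEvent f lam A y p k
    set W : Set Ω := {ω | f (iterate A y p (k + 1) ω) ≤ optValue f + lam} with hW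
    have hB : MeasurableSet[history A y p k] B := measurableSet_missEvent hf lam k
    have hG := (isClosed_successSet (d := d) S x s).measurableSet
    set R : Set Ω := {ω | (p k ω, A (k + 1) ω) ∈ successSet d S x s}
    have hR : MeasurableSet[halfHistory A y p (k + 1)] R :=
      ((measurable_halfHistory_p k).prodMk (measurable_halfHistory_A k)) hG
    have h1 : τ * μ.real B ≤ μ.real (B ∩ R) := by
      have := ENNReal.toReal_mono (measure_ne_top _ _)
        (le_measure_inter_success h hB hG (hsucc k))
      rwa [ENNReal.toReal_mul, ENNReal.toReal_ofReal hτ.1] at this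
    -- `B ∩ R` is decided before `y (k + 1)` is chosen, so the accuracy bound applies to it.
    have h2 := le_measure_inter_solved h hρ.1 hacc (k := k + 1) (by omega)
      (((history_le_halfHistory k) _ hB).inter hR)
    have h3 : B ∩ R ∩ solvedEvent f lam A y p (k + 1) ⊆ B ∩ W := by
      rintro ω ⟨⟨hωB, hωR⟩, hωV⟩
      refine ⟨hωB, ?_⟩
      have h4 := reducedValue_le_optValue hf hS hx hωR
      have h5 : f (iterate A y p (k + 1) ω) ≤ reducedValue f (A (k + 1) ω) (p k ω) + lam := hωV
      simp only [hW, Set.mem_ofPred_eq]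
      linarith
    have h4 : missEvent f lam A y p (k + 1) ⊆ B \ (B ∩ W) := by
      intro ω hω
      have hωB : ω ∈ B := fun j hj => hω j (by simp at hj ⊢; omega)
      refine ⟨hωB, fun hW' => ?_⟩
      exact absurd (hω (k + 1) (by simp)) (not_lt.2 hW'.2)
    have hWm : MeasurableSet W :=
      (history_le h _) _ ((hf.measurable.comp (measurable_iterate k)) measurableSet_Iic)
    have hBm : MeasurableSet B := history_le h _ _ hB
    have hτρ : τ * ρ ≤ 1 := mul_le_one₀ hτ.2 hρ.1.le hρ.2
    calc μ.real (missEvent f lam A y p (k + 1)) ≤ μ.real (B \ (B ∩ W)) := measureReal_mono h4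
      _ = μ.real B - μ.real (B ∩ W) :=
          measureReal_sdiff Set.inter_subset_left (hBm.inter hWm)
      _ ≤ μ.real B - ρ * (τ * μ.real B) := by
          have h5 : μ.real (B ∩ R ∩ solvedEvent f lam A y p (k + 1)) ≤ μ.real (B ∩ W) :=
            measureReal_mono h3
          have h6 := mul_le_mul_of_nonneg_left h1 hρ.1.le
          linarith
      _ = μ.real B * (1 - τ * ρ) := by ring
      _ ≤ (1 - τ * ρ) ^ k * (1 - τ * ρ) := mul_le_mul_of_nonneg_right ih (by linarith)
      _ = _ := (pow_succ _ _).symm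

lemma one_sub_pow_le {τ ρ ξ : ℝ} (hτ : τ ∈ Set.Ioc (0 : ℝ) 1) (hρ : ρ ∈ Set.Ioc (0 : ℝ) 1)
    (hξ : ξ ∈ Set.Ioo (0 : ℝ) 1) {k : ℕ} (hk : numEmbeddings τ ρ ξ ≤ k) :
    (1 - τ * ρ) ^ k ≤ 1 - ξ := by
  have hτρ : 0 < τ * ρ := mul_pos hτ.1 hρ.1
  have hτρ1 : τ * ρ ≤ 1 := mul_le_one₀ hτ.2 hρ.1.le hρ.2
  have h1 : |Real.log (1 - ξ)| / (τ * ρ) ≤ k := Nat.ceil_le.1 hk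
  rw [div_le_iff₀ hτρ, abs_of_neg (Real.log_neg (by linarith [hξ.2]) (by linarith [hξ.1]))] at h1
  calc (1 - τ * ρ) ^ k ≤ Real.exp (-(τ * ρ)) ^ k := by
        gcongr
        linarith [Real.add_one_le_exp (-(τ * ρ))]
    _ = Real.exp (-(k * (τ * ρ))) := by rw [← Real.exp_nat_mul]; congr 1; ring
    _ ≤ Real.exp (Real.log (1 - ξ)) := Real.exp_le_exp.2 (by linarith)
    _ = 1 - ξ := Real.exp_log (by linarith [hξ.2])

lemma one_le_numEmbeddings {τ ρ ξ : ℝ} (hτ : 0 < τ) (hρ : 0 < ρ)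
    (hξ : ξ ∈ Set.Ioo (0 : ℝ) 1) : 1 ≤ numEmbeddings τ ρ ξ := by
  refine Nat.one_le_ceil_iff.2 ?_
  have := Real.log_neg (show 0 < 1 - ξ by linarith [hξ.2]) (by linarith [hξ.1])
  have : 0 < |Real.log (1 - ξ)| := abs_pos.2 this.ne
  positivity

/-- If each embedding is successful with probability at least `τ`, then `K_ξ` embeddings
suffice. -/
lemma le_measureReal_best [IsProbabilityMeasure μ] (h : IsRun A y p μ) (hf : Continuous f)
    {S : Finset (Fin D)} (hS : VariesOnlyAlong f (coordSubspace S)) {x : EuclideanSpace ℝ (Fin D)}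
    (hx : optValue f = f x) {xopt : ℕ → Ω → EuclideanSpace ℝ (Fin D)}
    (hbest : IsBestPoint f A y p xopt)
    {s τ ε lam ρ ξ : ℝ} (hτ : τ ∈ Set.Ioc (0 : ℝ) 1) (hle : lam < ε) (hρ : ρ ∈ Set.Ioc (0 : ℝ) 1)
    (hξ : ξ ∈ Set.Ioo (0 : ℝ) 1)
    (hsucc : ∀ k, ∀ᵐ ω ∂μ, ENNReal.ofReal τ ≤
      gaussianMatrixLaw D d {M | (p k ω, M) ∈ successSet d S x s})
    (hacc : AccuracyAssumption f lam ρ A y p μ) {k : ℕ} (hk : numEmbeddings τ ρ ξ ≤ k) :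
    μ.real {ω | xopt k ω ∈ approxMinimizers f ε} =
        μ.real {ω | f (xopt k ω) ≤ optValue f + ε} ∧
      ξ ≤ μ.real {ω | xopt k ω ∈ approxMinimizers f ε} := by
  have hk1 : 1 ≤ k := (one_le_numEmbeddings hτ.1 hρ.1 hξ).trans hk
  have heq : μ.real {ω | xopt k ω ∈ approxMinimizers f ε} =
      μ.real {ω | f (xopt k ω) ≤ optValue f + ε} := by
    refine measureReal_congr ?_
    have hall : ∀ᵐ ω ∂μ, ∀ j, 1 ≤ j → iterate A y p j ω ∈ box D := by
      rw [ae_all_iff]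
      intro j
      by_cases hj : 1 ≤ j
      · filter_upwards [h.feasible j hj] with ω hω _ using hω
      · exact ae_of_all _ fun ω hj' => absurd hj' hj
    filter_upwards [hall] with ω hω
    obtain ⟨j, hj, hxj, -⟩ := hbest k hk1 ω
    have hmem : xopt k ω ∈ box D := hxj ▸ hω j (Finset.mem_Icc.1 hj).1
    exact propext ⟨fun h => h.2, fun h => ⟨hmem, h⟩⟩
  refine ⟨heq, ?_⟩
  rw [heq]
  have hcover : Set.univ ⊆ {ω | f (xopt k ω) ≤ optValue f + ε} ∪ missEvent f lam A y p k := by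
    intro ω _
    by_cases hω : f (xopt k ω) ≤ optValue f + ε
    · exact Or.inl hω
    · refine Or.inr fun j hj => ?_
      obtain ⟨-, -, -, hmin⟩ := hbest k hk1 ω
      have := hmin j hj
      linarith [not_le.1 hω]
  have h1 := (measureReal_mono (μ := μ) hcover).trans (measureReal_union_le _ _)
  rw [probReal_univ] at h1
  have h2 := measureReal_missEvent_le h hf hS hx ⟨hτ.1.le, hτ.2⟩ hρ hsucc hacc k
  have h3 := one_sub_pow_le hτ hρ hξ hk
  linarith

end Run

/-! ### The choice of the radius -/

/-- The threshold `t` with `e^{-t²/2} = √(log (N + 1)) / (N + 1)`. -/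
noncomputable def threshold (N : ℕ) : ℝ :=
  √(2 * Real.log (N + 1) - Real.log (Real.log (N + 1)))

section Threshold

variable {N : ℕ}

lemma log_succ_pos (hN : 1 ≤ N) : 0 < Real.log ((N : ℝ) + 1) := by
  refine Real.log_pos ?_
  have : (1 : ℝ) ≤ N := by exact_mod_cast hN
  linarith

lemma threshold_sq (hN : 1 ≤ N) :
    threshold N ^ 2 = 2 * Real.log (N + 1) - Real.log (Real.log (N + 1)) := by
  refine Real.sq_sqrt ?_
  have h := log_succ_pos hN
  linarith [Real.log_le_sub_one_of_pos h]

lemma threshold_nonneg (N : ℕ) : 0 ≤ threshold N := Real.sqrt_nonneg _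

lemma log_add_one_le_threshold_sq (hN : 1 ≤ N) :
    Real.log (N + 1) + 1 ≤ threshold N ^ 2 := by
  rw [threshold_sq hN]
  linarith [Real.log_le_sub_one_of_pos (log_succ_pos hN)]

lemma one_le_threshold (hN : 1 ≤ N) : 1 ≤ threshold N := by
  have h1 := log_add_one_le_threshold_sq hN
  have h2 := log_succ_pos hN
  nlinarith [threshold_nonneg N]

lemma exp_neg_threshold_sq (hN : 1 ≤ N) :
    Real.exp (-threshold N ^ 2 / 2) = √(Real.log (N + 1)) / (N + 1) := by
  have hL := log_succ_pos hN
  have h1 : -threshold N ^ 2 / 2 = Real.log (Real.log (N + 1)) / 2 - Real.log (N + 1) := by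
    rw [neg_div, threshold_sq hN]; ring
  rw [h1, Real.exp_sub, Real.exp_log (by positivity), ← Real.log_sqrt hL.le,
    Real.exp_log (Real.sqrt_pos.2 hL)]

/-- As t ≥ √(log (N + 1)), the division by t in the tail bound cancels the numerator of e^(-t²/2) =
√(log (N + 1)) / (N + 1). -/
lemma centralBound_threshold (hN : 1 ≤ N) :
    1 - 1 / ((N : ℝ) + 1) ≤ centralBound (threshold N) := by
  have h1 : √(Real.log (N + 1)) ≤ threshold N := by
    refine Real.sqrt_le_left (threshold_nonneg N) |>.2 ?_
    linarith [log_add_one_le_threshold_sq hN]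
  have ht : 0 < threshold N := by linarith [one_le_threshold hN]
  unfold centralBound
  rw [exp_neg_threshold_sq hN]
  gcongr 1 - ?_
  rw [div_div, div_le_div_iff₀ (by positivity) (by positivity)]
  nlinarith [show (0 : ℝ) < N + 1 by positivity]

lemma centralBound_threshold_pos (hN : 1 ≤ N) : 0 < centralBound (threshold N) := by
  refine lt_of_lt_of_le ?_ (centralBound_threshold hN)
  have : (1 : ℝ) ≤ N := by exact_mod_cast hN
  rw [sub_pos, div_lt_one (by positivity)]
  linarith

lemma centralBound_threshold_le_one (hN : 1 ≤ N) : centralBound (threshold N) ≤ 1 := by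
  have ht : 0 < threshold N := by linarith [one_le_threshold hN]
  exact (centralBound_le ht).trans measureReal_le_one

/-- 1 - 1/(N + 1) is the inverse of 1 + 1/N ≤ e^(1/N), so N such factors cost only a constant. -/
lemma exp_neg_one_le_centralBound_pow (hN : 1 ≤ N) :
    Real.exp (-1) ≤ centralBound (threshold N) ^ N := by
  have hN0 : (0 : ℝ) < N := by exact_mod_cast hN
  have h1 : (1 + 1 / (N : ℝ)) ≤ Real.exp (1 / N) := by
    linarith [Real.add_one_le_exp (1 / (N : ℝ))]
  have h2 : (1 - 1 / ((N : ℝ) + 1)) = (1 + 1 / (N : ℝ))⁻¹ := by field_simp; ring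
  calc Real.exp (-1) = (Real.exp (1 / N))⁻¹ ^ N := by
        rw [← Real.exp_neg, ← Real.exp_nat_mul]
        congr 1
        field_simp
    _ ≤ (1 - 1 / ((N : ℝ) + 1)) ^ N := by
        rw [h2]
        gcongr
    _ ≤ _ := by
        refine pow_le_pow_left₀ ?_ (centralBound_threshold hN) N
        rw [h2]; positivity

end Threshold

/-! ### The success probability as a function of the dimension -/

/-- The lower bound for the success probability of an embedding of `ℝ^d` when there are `n`
effective and `N` other coordinates, and the constraint in each of the latter costs a factor
`κ`. -/
noncomputable def successBound (κ : ℝ) (n d N : ℕ) : ℝ :=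
  tailBound (d + 1 - n) (√n * threshold N) * (κ * centralBound (threshold N)) ^ N

section SuccessBound

variable {n d N : ℕ} {κ : ℝ}

lemma one_le_sqrt_mul_threshold (hn : 1 ≤ n) (hN : 1 ≤ N) : 1 ≤ √n * threshold N :=
  one_le_mul_of_one_le_of_one_le (Real.one_le_sqrt.2 (by exact_mod_cast hn)) (one_le_threshold hN)

lemma successBound_mem (hκ : κ ∈ Set.Ioc (0 : ℝ) 1) (hn : 1 ≤ n) (hnd : n ≤ d) (hN : 1 ≤ N) :
    successBound κ n d N ∈ Set.Ioc (0 : ℝ) 1 := by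
  have hu := one_le_sqrt_mul_threshold hn hN
  have hc := centralBound_threshold_pos hN
  have hκc : 0 < κ * centralBound (threshold N) := mul_pos hκ.1 hc
  have ht := tailBound_pos (m := d + 1 - n) (show 0 < √n * threshold N by linarith)
  refine ⟨mul_pos ht (pow_pos hκc N), mul_le_one₀ ?_ (pow_pos hκc N).le (pow_le_one₀ hκc.le ?_)⟩
  · rw [← ENNReal.ofReal_le_one]
    exact (tailBound_le (by omega) hu).trans prob_le_one
  · exact mul_le_one₀ hκ.2 hc.le (centralBound_threshold_le_one hN)

/-- Let L = log (N + 1), m = d + 1 - n and u = √n t. As √L ≤ t ≤ √(2L), the factor u^m / u² is at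
least a constant times L^(m/2 - 1), while e^(-u²/2) = (√L / (N + 1))^n. The exponents of L add up to
(d - 1)/2. -/
lemma exists_le_tailBound (hn : 1 ≤ n) (hnd : n ≤ d) : ∃ c : ℝ, 0 < c ∧ ∀ N : ℕ, 1 ≤ N →
    1 ≤ Real.log ((N : ℝ) + 1) →
      c * (Real.log ((N : ℝ) + 1) ^ (((d : ℝ) - 1) / 2) / ((N : ℝ) + 1) ^ n) ≤
        tailBound (d + 1 - n) (√n * threshold N) := by
  set m := d + 1 - n with hm
  set b : ℝ := (√(2 * Real.pi))⁻¹ ^ m * Real.exp (-(3 / 2)) *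
    (volume (Metric.ball (0 : EuclideanSpace ℝ (Fin m)) 1)).toReal with hb
  have hb0 : 0 < b := by
    have h : 0 < (volume (Metric.ball (0 : EuclideanSpace ℝ (Fin m)) 1)).toReal :=
      ENNReal.toReal_pos (Metric.measure_ball_pos _ _ one_pos).ne' measure_ball_lt_top.ne
    positivity
  have hn0 : (0 : ℝ) < n := by exact_mod_cast hn
  refine ⟨b / (2 * n), by positivity, fun N hN hL => ?_⟩
  set L := Real.log ((N : ℝ) + 1) with hLdef
  set t := threshold N with ht
  have hL0 : 0 < L := by linarith
  have ht1 : 1 ≤ t := one_le_threshold hN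
  have ht2 : t ^ 2 ≤ 2 * L := by
    rw [ht, threshold_sq hN]
    linarith [Real.log_nonneg hL]
  have hsq : (√n * t) ^ 2 = n * t ^ 2 := by rw [mul_pow, Real.sq_sqrt hn0.le]
  have hLu : √L ≤ √n * t := by
    have h1 : √L ≤ t := (Real.sqrt_le_left (by linarith)).2
      (by linarith [log_add_one_le_threshold_sq hN])
    exact h1.trans (le_mul_of_one_le_left (by linarith)
      (Real.one_le_sqrt.2 (by exact_mod_cast hn)))
  have hexp : Real.exp (-(√n * t) ^ 2 / 2) = √L ^ n / ((N : ℝ) + 1) ^ n := by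
    rw [← div_pow, ← exp_neg_threshold_sq hN, ← Real.exp_nat_mul, hsq]
    congr 1
    ring
  have hpow : √L ^ m * √L ^ n / L = L ^ (((d : ℝ) - 1) / 2) := by
    rw [← pow_add, show m + n = d + 1 by omega, Real.sqrt_eq_rpow, ← Real.rpow_natCast,
      ← Real.rpow_mul hL0.le, div_eq_mul_inv, ← Real.rpow_neg_one, ← Real.rpow_add hL0]
    congr 1
    push_cast
    ring
  calc b / (2 * n) * (L ^ (((d : ℝ) - 1) / 2) / ((N : ℝ) + 1) ^ n)
      = b * (√L ^ m / (n * (2 * L)) * (√L ^ n / ((N : ℝ) + 1) ^ n)) := by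
        rw [← hpow]
        field_simp
    _ ≤ b * ((√n * t) ^ m / (√n * t) ^ 2 * Real.exp (-(√n * t) ^ 2 / 2)) := by
        rw [hexp, hsq]
        gcongr
    _ = tailBound m (√n * t) := rfl

lemma exists_le_successBound (hn : 1 ≤ n) (hnd : n ≤ d) (hκ : 0 ≤ κ) : ∃ c : ℝ, 0 < c ∧
    ∀ N : ℕ, 1 ≤ N → 1 ≤ Real.log ((N : ℝ) + 1) →
      c * (κ ^ N * (Real.log ((N : ℝ) + 1) ^ (((d : ℝ) - 1) / 2) / ((N : ℝ) + 1) ^ n)) ≤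
        successBound κ n d N := by
  obtain ⟨c, hc, h⟩ := exists_le_tailBound hn hnd
  refine ⟨c * Real.exp (-1), by positivity, fun N hN hL => ?_⟩
  have h1 := h N hN hL
  have h2 := exp_neg_one_le_centralBound_pow hN
  unfold successBound
  rw [mul_pow]
  calc _ = c * (Real.log ((N : ℝ) + 1) ^ (((d : ℝ) - 1) / 2) / ((N : ℝ) + 1) ^ n) *
          (κ ^ N * Real.exp (-1)) := by ring
    _ ≤ _ := by
        have hc0 := centralBound_threshold_pos hN
        have ht := tailBound_pos (m := d + 1 - n)
          (show 0 < √n * threshold N by linarith [one_le_sqrt_mul_threshold hn hN])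
        gcongr

end SuccessBound

/-! ### Rates -/

/-- The ceiling adds at most 1, which the summand 1 in the constant c⁻¹ + 1 absorbs as soon as r D ≥
1 / |log (1 - ξ)|. Since ρ ≤ 1, this threshold works for all ρ at once. -/
lemma hasRate_of_le {τ r : ℕ → ℝ} {c : ℝ} (hc : 0 < c) (hr : Tendsto r atTop atTop)
    (h : ∀ᶠ D in atTop, c / r D ≤ τ D) : HasRate τ r := by
  refine ⟨c⁻¹ + 1, by positivity, fun ξ hξ => ?_⟩
  have hl := Real.log_neg (show 0 < 1 - ξ by linarith [hξ.2]) (by linarith [hξ.1])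
  set l := |Real.log (1 - ξ)|
  have hl0 : 0 < l := abs_pos.2 hl.ne
  filter_upwards [h, hr.eventually_ge_atTop (1 / l)] with D hD hrD ρ hρ
  have hr0 : 0 < r D := lt_of_lt_of_le (by positivity) hrD
  have hτ0 : 0 < τ D := lt_of_lt_of_le (by positivity) hD
  have hρ0 := hρ.1
  have h1 : (numEmbeddings (τ D) ρ ξ : ℝ) < l / (τ D * ρ) + 1 :=
    Nat.ceil_lt_add_one (by positivity)
  have h2 : l / (τ D * ρ) ≤ l / (c / r D * ρ) := by gcongr
  have h3 : l / (c / r D * ρ) = l / ρ * (c⁻¹ * r D) := by field_simp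
  have h4 : 1 ≤ l / ρ * r D := by
    rw [div_le_iff₀ hl0] at hrD
    rw [div_mul_eq_mul_div, one_le_div₀ hρ0]
    linarith [hρ.2]
  calc (numEmbeddings (τ D) ρ ξ : ℝ) ≤ l / ρ * (c⁻¹ * r D) + l / ρ * r D := by linarith
    _ = _ := by ring

lemma tendsto_div_log_rpow (s : ℝ) :
    Tendsto (fun x : ℝ => x / Real.log x ^ s) atTop atTop := by
  have h1 := (isLittleO_log_rpow_rpow_atTop s one_pos).tendsto_div_nhds_zero
  have h2 : ∀ᶠ x : ℝ in atTop, 0 < Real.log x ^ s / x ^ (1 : ℝ) := by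
    filter_upwards [eventually_gt_atTop 1] with x hx
    have := Real.log_pos hx
    positivity
  have h3 := (tendsto_nhdsWithin_iff.2 ⟨h1, h2⟩).inv_tendsto_nhdsGT_zero
  refine h3.congr fun x => ?_
  simp

lemma tendsto_sub_add_one (n : ℕ) :
    Tendsto (fun D : ℕ => (D : ℝ) - n + 1) atTop atTop :=
  tendsto_atTop_add_const_right _ _
    (tendsto_atTop_add_const_right _ (-(n : ℝ)) tendsto_natCast_atTop_atTop)

lemma eventually_natCast_sub (n : ℕ) : ∀ᶠ D : ℕ in atTop, 1 ≤ D - n ∧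
    (D : ℝ) - n + 1 = ((D - n : ℕ) : ℝ) + 1 ∧ 1 ≤ Real.log (((D - n : ℕ) : ℝ) + 1) := by
  filter_upwards [eventually_gt_atTop n,
    (Real.tendsto_log_atTop.comp (tendsto_sub_add_one n)).eventually_ge_atTop 1] with D hD hL
  have h : (D : ℝ) - n + 1 = ((D - n : ℕ) : ℝ) + 1 := by rw [Nat.cast_sub hD.le]
  exact ⟨by omega, h, by rw [← h]; exact hL⟩

/-- One power of D - n + 1 outgrows any power of the logarithm; n ≥ 1 provides it. -/
lemma tendsto_algRate {n : ℕ} (hn : 1 ≤ n) (d : ℕ) : Tendsto (algRate n d) atTop atTop := by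
  refine tendsto_atTop_mono' _ ?_ ((tendsto_div_log_rpow (((d : ℝ) - 1) / 2)).comp
    (tendsto_sub_add_one n))
  filter_upwards [eventually_natCast_sub n] with D ⟨_, h2, h3⟩
  simp only [Function.comp_apply, algRate, h2]
  gcongr
  exact le_self_pow₀ (by linarith [Nat.cast_nonneg (α := ℝ) (D - n)]) (by omega)

/-- Here 2^(D - n) supplies the linear growth, so n = 0 is allowed. -/
lemma tendsto_expRate (n d : ℕ) : Tendsto (expRate n d) atTop atTop := by
  refine tendsto_atTop_mono' _ ?_ ((tendsto_div_log_rpow (((d : ℝ) - 1) / 2)).comp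
    (tendsto_sub_add_one n))
  filter_upwards [eventually_natCast_sub n] with D ⟨_, h2, h3⟩
  simp only [Function.comp_apply, expRate, h2]
  gcongr
  have h4 : ((D - n : ℕ) : ℝ) + 1 ≤ 2 ^ (D - n) := by exact_mod_cast Nat.lt_two_pow_self
  have h5 : (1 : ℝ) ≤ (((D - n : ℕ) : ℝ) + 1) ^ n :=
    one_le_pow₀ (by linarith [Nat.cast_nonneg (α := ℝ) (D - n)])
  exact h4.trans (le_mul_of_one_le_right (by positivity) h5)

lemma hasRate_successBound_algRate {n d : ℕ} (hn : 1 ≤ n) (hnd : n ≤ d) :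
    HasRate (fun D => successBound 1 n d (D - n)) (algRate n d) := by
  obtain ⟨c, hc, h⟩ := exists_le_successBound (κ := 1) hn hnd zero_le_one
  refine hasRate_of_le hc (tendsto_algRate hn d) ?_
  filter_upwards [eventually_natCast_sub n] with D ⟨h1, h2, h3⟩
  refine le_trans (le_of_eq ?_) (h (D - n) h1 h3)
  rw [algRate, h2, one_pow, one_mul, div_div_eq_mul_div, mul_div_assoc]

lemma hasRate_successBound_expRate {n d : ℕ} (hn : 1 ≤ n) (hnd : n ≤ d) :
    HasRate (fun D => successBound (1 / 2) n d (D - n)) (expRate n d) := by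
  obtain ⟨c, hc, h⟩ := exists_le_successBound (κ := 1 / 2) hn hnd (by norm_num)
  refine hasRate_of_le hc (tendsto_expRate n d) ?_
  filter_upwards [eventually_natCast_sub n] with D ⟨h1, h2, h3⟩
  refine le_trans (le_of_eq ?_) (h (D - n) h1 h3)
  rw [expRate, h2, div_pow, one_pow]
  field_simp

/-! ### Success probabilities along a run -/

section Success

variable {D d : ℕ} {S : Finset (Fin D)} {x p : EuclideanSpace ℝ (Fin D)}

/-- The bound 2 on |x i - p i| and the radius 2 / t are both twice those of the centred case, so u =
√n t is the same in both. -/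
lemma successBound_le_of_mem_box (hS : 1 ≤ S.card) (hSd : S.card ≤ d) (hSD : S.card < D)
    (hx : x ∈ box D) (hp : p ∈ box D) :
    ENNReal.ofReal (successBound (1 / 2) S.card d (D - S.card)) ≤ gaussianMatrixLaw D d
      {A | (p, A) ∈ successSet d S x (2 / threshold (D - S.card))} := by
  have hN : 1 ≤ D - S.card := by omega
  have ht : 0 < threshold (D - S.card) := by linarith [one_le_threshold hN]
  refine le_gaussianMatrixLaw_successSet S (Finset.card_pos.1 hS) hSd hx
    (one_le_sqrt_mul_threshold hS hN) (by positivity)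
    (by linarith [centralBound_threshold_pos hN]) ?_
    fun i _ r hr hrs => half_centralBound_le (hp i) ht hr hrs
  have h1 : (√(S.card : ℝ) * threshold (D - S.card) * (2 / threshold (D - S.card))) ^ 2 =
      S.card * 4 := by
    rw [mul_assoc, mul_div_cancel₀ _ ht.ne', mul_pow, Real.sq_sqrt (by positivity)]
    norm_num
  rw [h1, ← nsmul_eq_mul]
  refine Finset.sum_le_card_nsmul _ _ _ fun i _ => ?_
  nlinarith [(hx i).1, (hx i).2, (hp i).1, (hp i).2]

lemma successBound_le_of_zero (hS : 1 ≤ S.card) (hSd : S.card ≤ d) (hSD : S.card < D)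
    (hx : x ∈ box D) :
    ENNReal.ofReal (successBound 1 S.card d (D - S.card)) ≤ gaussianMatrixLaw D d
      {A | (0, A) ∈ successSet d S x (1 / threshold (D - S.card))} := by
  have hN : 1 ≤ D - S.card := by omega
  have ht : 0 < threshold (D - S.card) := by linarith [one_le_threshold hN]
  unfold successBound
  rw [one_mul]
  refine le_gaussianMatrixLaw_successSet S (Finset.card_pos.1 hS) hSd hx
    (one_le_sqrt_mul_threshold hS hN) (by positivity) (centralBound_threshold_pos hN).le ?_
    fun i _ r hr hrs => by simpa using centralBound_le_of_center ht hr hrs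
  have h1 : (√(S.card : ℝ) * threshold (D - S.card) * (1 / threshold (D - S.card))) ^ 2 =
      S.card * 1 := by
    rw [mul_assoc, mul_one_div_cancel ht.ne', mul_one, Real.sq_sqrt (by positivity), mul_one]
  rw [h1, ← nsmul_eq_mul]
  refine Finset.sum_le_card_nsmul _ _ _ fun i _ => ?_
  simp only [PiLp.zero_apply, sub_zero]
  nlinarith [(hx i).1, (hx i).2]

/-- Without effective coordinates y = 0 always succeeds. -/
lemma gaussianMatrixLaw_successSet_empty (hp : p ∈ box D) :
    gaussianMatrixLaw D d {A | (p, A) ∈ successSet d ∅ x 0} = 1 := by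
  have h : {A : Fin D → Fin d → ℝ | (p, A) ∈ successSet d ∅ x 0} = Set.univ := by
    refine Set.eq_univ_of_forall fun A => ⟨0, by simp, ?_, by simp⟩
    simpa [embed] using hp
  rw [h, measure_univ]

end Success

end XREGO

/-! ### The two convergence statements -/

open XREGO in
theorem mainTheorem7 (de d : ℕ) (hd : de ≤ d) :
    (∃ τ : ℕ → ℝ,
      (∀ D, de < D → τ D ∈ Set.Ioc (0 : ℝ) 1) ∧
      XREGO.HasRate τ (XREGO.expRate de d) ∧
      ∀ (D : ℕ) (_ : de < D) (f : EuclideanSpace ℝ (Fin D) → ℝ)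
        (_ : XREGO.CoordinateAligned f de)
        (Ω : Type*) (_ : MeasurableSpace Ω) (μ : Measure Ω) (_ : IsProbabilityMeasure μ)
        (A : ℕ → Ω → Fin D → Fin d → ℝ) (y : ℕ → Ω → EuclideanSpace ℝ (Fin d))
        (p xopt : ℕ → Ω → EuclideanSpace ℝ (Fin D)) (_ : XREGO.IsRun A y p μ)
        (_ : XREGO.IsBestPoint f A y p xopt)
        (ε lam ρ ξ : ℝ) (_ : 0 < lam) (_ : lam < ε) (_ : ρ ∈ Set.Ioc (0 : ℝ) 1)
        (_ : XREGO.AccuracyAssumption f lam ρ A y p μ) (_ : ξ ∈ Set.Ioo (0 : ℝ) 1)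
        (k : ℕ) (_ : XREGO.numEmbeddings (τ D) ρ ξ ≤ k),
          μ.real {ω | xopt k ω ∈ XREGO.approxMinimizers f ε} =
            μ.real {ω | f (xopt k ω) ≤ XREGO.optValue f + ε} ∧
          ξ ≤ μ.real {ω | xopt k ω ∈ XREGO.approxMinimizers f ε}) ∧
    (1 ≤ de → ∃ τ₀ : ℕ → ℝ,
      (∀ D, de < D → τ₀ D ∈ Set.Ioc (0 : ℝ) 1) ∧
      XREGO.HasRate τ₀ (XREGO.algRate de d) ∧
      ∀ (D : ℕ) (_ : de < D) (f : EuclideanSpace ℝ (Fin D) → ℝ)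
        (_ : XREGO.CoordinateAligned f de)
        (Ω : Type*) (_ : MeasurableSpace Ω) (μ : Measure Ω) (_ : IsProbabilityMeasure μ)
        (A : ℕ → Ω → Fin D → Fin d → ℝ) (y : ℕ → Ω → EuclideanSpace ℝ (Fin d))
        (p xopt : ℕ → Ω → EuclideanSpace ℝ (Fin D)) (_ : XREGO.IsRun A y p μ)
        (_ : ∀ k, ∀ᵐ ω ∂μ, p k ω = 0)
        (_ : XREGO.IsBestPoint f A y p xopt)
        (ε lam ρ ξ : ℝ) (_ : 0 < lam) (_ : lam < ε) (_ : ρ ∈ Set.Ioc (0 : ℝ) 1)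
        (_ : XREGO.AccuracyAssumption f lam ρ A y p μ) (_ : ξ ∈ Set.Ioo (0 : ℝ) 1)
        (k : ℕ) (_ : XREGO.numEmbeddings (τ₀ D) ρ ξ ≤ k),
          μ.real {ω | xopt k ω ∈ XREGO.approxMinimizers f ε} =
            μ.real {ω | f (xopt k ω) ≤ XREGO.optValue f + ε} ∧
          ξ ≤ μ.real {ω | xopt k ω ∈ XREGO.approxMinimizers f ε}) := by
  refine ⟨?_, fun hde => ⟨fun D => successBound 1 de d (D - de),
    fun D hD => successBound_mem ⟨one_pos, le_rfl⟩ hde hd (by omega),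
    hasRate_successBound_algRate hde hd, ?_⟩⟩
  · rcases Nat.eq_zero_or_pos de with rfl | hde
    -- With no effective coordinates every embedding is successful, so τ = 1; the bounds through
    -- `successBound` need at least one equation.
    · refine ⟨fun _ => 1, fun _ _ => ⟨one_pos, le_rfl⟩, hasRate_of_le one_pos (tendsto_expRate 0 d)
        ?_, ?_⟩
      · filter_upwards [(tendsto_expRate 0 d).eventually_ge_atTop 1] with D hD
        exact div_le_one_of_le₀ hD (by linarith)
      · intro D _ f hf Ω _ μ _ A y p xopt hrun hbest ε lam ρ ξ _ hle hρ hacc hξ k hk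
        obtain ⟨S, hcard, hS⟩ := hf.aligned
        obtain rfl := Finset.card_eq_zero.1 hcard
        obtain ⟨x, -, hx⟩ := exists_optValue_eq hf.continuous
        refine le_measureReal_best hrun hf.continuous hS hx hbest (s := 0) ⟨one_pos, le_rfl⟩ hle hρ
          hξ (fun j => ?_) hacc hk
        filter_upwards [hrun.p_mem j] with ω hω
        rw [gaussianMatrixLaw_successSet_empty hω, ENNReal.ofReal_one]
    · refine ⟨fun D => successBound (1 / 2) de d (D - de),
        fun D hD => successBound_mem (by norm_num) hde hd (by omega),
        hasRate_successBound_expRate hde hd, ?_⟩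
      intro D hD f hf Ω _ μ _ A y p xopt hrun hbest ε lam ρ ξ _ hle hρ hacc hξ k hk
      obtain ⟨S, rfl, hS⟩ := hf.aligned
      obtain ⟨x, hxbox, hx⟩ := exists_optValue_eq hf.continuous
      refine le_measureReal_best hrun hf.continuous hS hx hbest
        (s := 2 / threshold (D - S.card))
        (successBound_mem (by norm_num) hde hd (by omega)) hle hρ hξ (fun j => ?_) hacc hk
      filter_upwards [hrun.p_mem j] with ω hω
      exact successBound_le_of_mem_box hde hd hD hxbox hω
  · intro D hD f hf Ω _ μ _ A y p xopt hrun hp0 hbest ε lam ρ ξ _ hle hρ hacc hξ k hk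
    obtain ⟨S, rfl, hS⟩ := hf.aligned
    obtain ⟨x, hxbox, hx⟩ := exists_optValue_eq hf.continuous
    refine le_measureReal_best hrun hf.continuous hS hx hbest
      (s := 1 / threshold (D - S.card))
      (successBound_mem ⟨one_pos, le_rfl⟩ hde hd (by omega)) hle hρ hξ (fun j => ?_) hacc hk
    filter_upwards [hp0 j] with ω hω
    rw [hω]
    exact successBound_le_of_zero hde hd hD hxbox
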